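/- Let $R$ be a unital associative ring (not necessarily commutative); modules are left $R$-modules. A module is *Gorenstein projective* if it is a syzygy (the image of a differential) of an acyclic complex $P_*$ of projective modules, indexed by $\mathbb{Z}$, such that $\mathrm{Hom}_R(P_*,Q)$ is acyclic for every projective module $Q$. A module is a *PGF-module* (projectively coresolved Gorenstein flat) if it is a syzygy of an acyclic complex $P_*$ of projective modules, indexed by $\mathbb{Z}$, such that $I\otimes_R P_*$ is acyclic for every injective right $R$-module $I$. For a module $M$, the *Gorenstein projective dimension* $\mathrm{Gpd}_R M$ (respectively the *PGF-dimension* $\mathrm{PGF\text{-}dim}_R M$) is the least $n\ge 0$ for which there is an exact sequence $$0\to G_n\to\cdots\to G_0\to M\to 0$$ with all $G_i$ Gorenstein projective (respectively PGF-modules), and it is $\infty$ if no such $n$ exists. Let $\mathrm{pd}_R M\in\{0,1,2,\dots\}\cup\{\infty\}$ be the usual projective dimension, with $\mathrm{pd}_R 0=0$. **Corollary 3.7.** Let $M$ be an $R$-module. (i) If $\mathrm{pd}_R M<\infty$, then $\mathrm{PGF\text{-}dim}_R M=\mathrm{pd}_R M$. (ii) If $\mathrm{PGF\text{-}dim}_R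 M<\infty$, then $\mathrm{Gpd}_R M=\mathrm{PGF\text{-}dim}_R M$. Consequently, $\mathrm{Gpd}_R M\le \mathrm{PGF\text{-}dim}_R M\le \mathrm{pd}_R M$ for every $R$-module $M$. -/

import Mathlib

open scoped TensorProduct

universe u

namespace PGF

/-! ### The tensor product over a noncommutative ring

A right `R`-module is a left module over `Rᵐᵒᵖ`, with `x · r = MulOpposite.op r • x`. -/

section Tensor

variable (R : Type u) [Ring R] (I : Type u) [AddCommGroup I] [Module Rᵐᵒᵖ I]

/-- The subgroup of `I ⊗_ℤ P` generated by all `(x · r) ⊗ p - x ⊗ (r • p)`. -/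
def balancingRelations (P : Type u) [AddCommGroup P] [Module R P] : Submodule ℤ (I ⊗[ℤ] P) :=
  Submodule.span ℤ {t | ∃ (x : I) (r : R) (p : P),
    t = (MulOpposite.op r • x) ⊗ₜ[ℤ] p - x ⊗ₜ[ℤ] (r • p)}

/-- The abelian group `I ⊗_R P`, for a right `R`-module `I` and a left `R`-module `P`. -/
abbrev RTensor (P : Type u) [AddCommGroup P] [Module R P] : Type u :=
  (I ⊗[ℤ] P) ⧸ balancingRelations R I P

variable {P Q : Type u} [AddCommGroup P] [Module R P] [AddCommGroup Q] [Module R Q]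

theorem balancingRelations_le_comap (f : P →ₗ[R] Q) :
    balancingRelations R I P ≤
      (balancingRelations R I Q).comap (f.toAddMonoidHom.toIntLinearMap.lTensor I) := by
  refine Submodule.span_le.2 ?_
  rintro _ ⟨x, r, p, rfl⟩
  refine Submodule.subset_span ⟨x, r, f p, ?_⟩
  simp

/-- The homomorphism `I ⊗_R f : I ⊗_R P → I ⊗_R Q` induced by an `R`-linear map `f : P → Q`;
it sends the class of `x ⊗ p` to the class of `x ⊗ f p`. -/
def RTensor.map (f : P →ₗ[R] Q) : RTensor R I P →ₗ[ℤ] RTensor R I Q :=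
  Submodule.mapQ _ _ (f.toAddMonoidHom.toIntLinearMap.lTensor I)
    (balancingRelations_le_comap R I f)

end Tensor

/-- An acyclic complex `⋯ → X (n+1) → X n → X (n-1) → ⋯` of projective left `R`-modules,
indexed by `ℤ`. -/
structure AcyclicProjComplex (R : Type u) [Ring R] where
  /-- the modules -/
  X : ℤ → Type u
  [addCommGroup : ∀ n, AddCommGroup (X n)]
  [module : ∀ n, Module R (X n)]
  /-- the differentials -/
  d : ∀ n, X (n + 1) →ₗ[R] X n
  projective : ∀ n, Module.Projective R (X n)
  exact : ∀ n, Function.Exact (d (n + 1)) (d n)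

attribute [instance] AcyclicProjComplex.addCommGroup AcyclicProjComplex.module

namespace AcyclicProjComplex

variable {R : Type u} [Ring R] (C : AcyclicProjComplex R)

/-- `Hom_R(C, Q)` is acyclic. -/
def HomAcyclic (Q : Type u) [AddCommGroup Q] [Module R Q] : Prop :=
  ∀ n : ℤ, Function.Exact (fun g : C.X n →ₗ[R] Q => g ∘ₗ C.d n)
    (fun g : C.X (n + 1) →ₗ[R] Q => g ∘ₗ C.d (n + 1))

/-- `I ⊗_R C` is acyclic. -/
def TensorAcyclic (I : Type u) [AddCommGroup I] [Module Rᵐᵒᵖ I] : Prop :=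
  ∀ n : ℤ, Function.Exact (RTensor.map R I (C.d (n + 1))) (RTensor.map R I (C.d n))

/-- `M` is (isomorphic to) a syzygy of `C`, i.e. to the image of one of its differentials. -/
def IsSyzygy (M : Type u) [AddCommGroup M] [Module R M] : Prop :=
  ∃ n : ℤ, Nonempty (M ≃ₗ[R] LinearMap.range (C.d n))

end AcyclicProjComplex

/-- `M` is Gorenstein projective: a syzygy of a complete projective resolution. -/
def IsGorensteinProjective (R : Type u) [Ring R] (M : Type u) [AddCommGroup M] [Module R M] :
    Prop :=
  ∃ C : AcyclicProjComplex R,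
    (∀ (Q : Type u) [AddCommGroup Q] [Module R Q], Module.Projective R Q → C.HomAcyclic Q) ∧
    C.IsSyzygy M

/-- `M` is a PGF-module (projectively coresolved Gorenstein flat): a syzygy of an acyclic complex
of projective modules that stays acyclic under `I ⊗_R -` for all injective right modules `I`. -/
def IsPGF (R : Type u) [Ring R] (M : Type u) [AddCommGroup M] [Module R M] : Prop :=
  ∃ C : AcyclicProjComplex R,
    (∀ (I : Type u) [AddCommGroup I] [Module Rᵐᵒᵖ I],
      Module.Injective Rᵐᵒᵖ I → C.TensorAcyclic I) ∧
    C.IsSyzygy M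

/-- An exact sequence `0 → G n → ⋯ → G 1 → G 0 → M → 0` whose terms `G 0, …, G n` belong to the
class `𝒢` of left `R`-modules. It is written as a sequence indexed by `ℕ` with `G i = 0` for
`i > n`. -/
structure Resolution (R : Type u) [Ring R]
    (𝒢 : ∀ (G : Type u) [AddCommGroup G] [Module R G], Prop)
    (M : Type u) [AddCommGroup M] [Module R M] (n : ℕ) where
  /-- the modules -/
  G : ℕ → Type u
  [addCommGroup : ∀ i, AddCommGroup (G i)]
  [module : ∀ i, Module R (G i)]
  /-- the differentials -/
  d : ∀ i, G (i + 1) →ₗ[R] G i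
  /-- the augmentation -/
  ε : G 0 →ₗ[R] M
  mem : ∀ i, i ≤ n → 𝒢 (G i)
  zero : ∀ i, n < i → Subsingleton (G i)
  surjective : Function.Surjective ε
  exact_zero : Function.Exact (d 0) ε
  exact_succ : ∀ i, Function.Exact (d (i + 1)) (d i)

attribute [instance] Resolution.addCommGroup Resolution.module

/-- The length of a shortest resolution of `M` by modules in the class `𝒢`, and `⊤` if `M` has no
such resolution of finite length. -/
noncomputable def resolutionDim (R : Type u) [Ring R]
    (𝒢 : ∀ (G : Type u) [AddCommGroup G] [Module R G], Prop)
    (M : Type u) [AddCommGroup M] [Module R M] : ℕ∞ :=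
  sInf {l : ℕ∞ | ∃ n : ℕ, l = n ∧ Nonempty (Resolution R 𝒢 M n)}

/-- The PGF-dimension. -/
noncomputable def pgfDim (R : Type u) [Ring R] (M : Type u) [AddCommGroup M] [Module R M] : ℕ∞ :=
  resolutionDim R (fun G _ _ => IsPGF R G) M

/-- The Gorenstein projective dimension. -/
noncomputable def gpd (R : Type u) [Ring R] (M : Type u) [AddCommGroup M] [Module R M] : ℕ∞ :=
  resolutionDim R (fun G _ _ => IsGorensteinProjective R G) M

/-- The projective dimension. Mathlib's `projectiveDimension` takes the value `⊥` exactly at zero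
modules; here, as for the other two dimensions, a zero module has dimension `0`. -/
noncomputable def pd (R : Type u) [Ring R] (M : Type u) [AddCommGroup M] [Module R M] : ℕ∞ :=
  (CategoryTheory.projectiveDimension (ModuleCat.of R M)).unbotD 0

end PGF

/-! The crux is that PGF-modules are Gorenstein projective: if `C` is an acyclic complex of
projectives and `I ⊗ C` is acyclic for all injective right modules `I`, then `Hom(C, F)` is acyclic
for every projective `F`. By duality (`AcyclicProjComplex.tensorAcyclic_iff`) the hypothesis says
that `Hom(C, I⁺)` is acyclic, where `⁺` is `Hom_ℤ(-, ℚ/ℤ)`. Totalising `C` and adding contractible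
summands reduces the claim to a differential on a free module with basis `B`, given by rows.

There the right module `F⁺` is injective because `F` is projective, and so are its powers. Exactness
over all powers bounds supports uniformly: cycles over `F⁺` supported in a given finite set are
boundaries of vectors supported in one fixed finite set. A finite system of equations over `F` is
solvable when characters raise no obstruction, so the uniform bounds provide finite solutions and a
Mittag-Leffler condition. Hence a solution of `h ∘ D = f` on a good subset of `B` extends to a
larger good subset by a countable procedure (`exists_good_extension`), and Zorn's lemma finishes.

The rest is relative homological algebra, done once for syzygies of acyclic complexes of projectives
that stay acyclic under `Hom(-, N)` for `N` in a class containing the projectives; both PGF and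
Gorenstein projective modules have this form. Such modules have no higher `Ext` into the class. A
resolution of length `k` therefore kills `Ext^i(M, Q)` for `i > k` and `Q` projective, and these
groups detect a finite projective dimension, which gives (i). For (ii), a PGF-resolution of positive
length yields `0 → Y → E → M → 0` with `E` PGF and `pd Y` finite (`HasRes.exists_approximation`).
Vanishing of `Ext^i(M, Q)` above `Gpd M` bounds `pd Y`, and the sequence becomes a short enough
PGF-resolution; when `Gpd M = 0` it splits and `M` is PGF by cancellation of the projective `Y`. -/

namespace PGF

/-! ### Character modules over a noncommutative ring -/

/-- The right module `Hom_ℤ(F, ℚ/ℤ)` of a left module `F`. -/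
def RightDual (F : Type u) [AddCommGroup F] : Type u := F →+ AddCircle (1 : ℚ)

/-- The left module `Hom_ℤ(J, ℚ/ℤ)` of a right module `J`. -/
def LeftDual (J : Type u) [AddCommGroup J] : Type u := J →+ AddCircle (1 : ℚ)

namespace RightDual

variable {F : Type u} [AddCommGroup F]

instance : AddCommGroup (RightDual F) := inferInstanceAs (AddCommGroup (F →+ AddCircle (1 : ℚ)))

/-- Evaluation of a character at an element. -/
def eval (v : F) : RightDual F →+ AddCircle (1 : ℚ) := AddMonoidHom.eval v

theorem eval_add (v w : F) : eval (v + w) = eval v + eval w :=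
  AddMonoidHom.ext fun c => map_add (show F →+ AddCircle (1 : ℚ) from c) v w

theorem ext_eval {c c' : RightDual F} (h : ∀ v, eval v c = eval v c') : c = c' :=
  DFunLike.ext (F := F →+ AddCircle (1 : ℚ)) c c' h

variable {R : Type u} [Ring R] [Module R F]

instance : Module Rᵐᵒᵖ (RightDual F) where
  smul r c := AddMonoidHom.comp (show F →+ AddCircle (1 : ℚ) from c)
    (DistribSMul.toAddMonoidHom F r.unop)
  one_smul c := ext_eval fun v => congrArg (show F →+ AddCircle (1 : ℚ) from c) (one_smul R v)
  mul_smul r s c := ext_eval fun v =>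
    congrArg (show F →+ AddCircle (1 : ℚ) from c) (mul_smul s.unop r.unop v)
  smul_zero _ := rfl
  smul_add _ _ _ := rfl
  add_smul r s c := ext_eval fun v =>
    (congrArg (show F →+ AddCircle (1 : ℚ) from c) (add_smul r.unop s.unop v)).trans
      (map_add (show F →+ AddCircle (1 : ℚ) from c) _ _)
  zero_smul c := ext_eval fun v =>
    (congrArg (show F →+ AddCircle (1 : ℚ) from c) (zero_smul R v)).trans
      (map_zero (show F →+ AddCircle (1 : ℚ) from c))

theorem eval_smul (r : R) (v : F) (c : RightDual F) :
    eval v (MulOpposite.op r • c) = eval (r • v) c := rfl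

end RightDual

namespace LeftDual

variable {J : Type u} [AddCommGroup J]

instance : AddCommGroup (LeftDual J) := inferInstanceAs (AddCommGroup (J →+ AddCircle (1 : ℚ)))

/-- A character regarded as a homomorphism. -/
def hom : LeftDual J →+ (J →+ AddCircle (1 : ℚ)) := AddMonoidHom.id _

theorem ext_hom {c c' : LeftDual J} (h : ∀ j, hom c j = hom c' j) : c = c' :=
  DFunLike.ext (F := J →+ AddCircle (1 : ℚ)) c c' h

variable {R : Type u} [Ring R] [Module Rᵐᵒᵖ J]

instance : Module R (LeftDual J) where
  smul r c := AddMonoidHom.comp (hom c) (DistribSMul.toAddMonoidHom J (MulOpposite.op r))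
  one_smul c := ext_hom fun v => congrArg (hom c) (one_smul Rᵐᵒᵖ v)
  mul_smul r s c := ext_hom fun v =>
    congrArg (hom c) (mul_smul (MulOpposite.op s) (MulOpposite.op r) v)
  smul_zero _ := rfl
  smul_add _ _ _ := rfl
  add_smul r s c := ext_hom fun v =>
    (congrArg (hom c) (add_smul (MulOpposite.op r) (MulOpposite.op s) v)).trans
      (map_add (hom c) _ _)
  zero_smul c := ext_hom fun v =>
    (congrArg (hom c) (zero_smul Rᵐᵒᵖ v)).trans (map_zero (hom c))

theorem hom_smul (r : R) (j : J) (c : LeftDual J) :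
    hom (r • c) j = hom c (MulOpposite.op r • j) := rfl

end LeftDual

/-- Characters separate the points outside a subgroup. -/
theorem exists_character_ne_zero {A : Type u} [AddCommGroup A] (H : AddSubgroup A) {a : A}
    (ha : a ∉ H) : ∃ χ : A →+ AddCircle (1 : ℚ), (∀ x ∈ H, χ x = 0) ∧ χ a ≠ 0 := by
  have h : (QuotientAddGroup.mk' H a) ≠ 0 := by
    simpa using ha
  obtain ⟨c, hc⟩ := CharacterModule.exists_character_apply_ne_zero_of_ne_zero h
  let c' : A ⧸ H →+ AddCircle (1 : ℚ) := c
  refine ⟨c'.comp (QuotientAddGroup.mk' H), fun x hx => ?_, hc⟩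
  have : QuotientAddGroup.mk' H x = 0 := by simpa using hx
  exact (congrArg c' this).trans (map_zero c')

theorem exists_character_extension {A A' : Type u} [AddCommGroup A] [AddCommGroup A']
    (f : A →+ A') (hf : Function.Injective f) (χ : A →+ AddCircle (1 : ℚ)) :
    ∃ χ' : A' →+ AddCircle (1 : ℚ), ∀ a, χ' (f a) = χ a := by
  obtain ⟨χ', h⟩ := CharacterModule.dual_surjective_of_injective (f.toIntLinearMap) hf χ
  exact ⟨χ', fun a => DFunLike.congr_fun h a⟩

theorem injective_pi {S : Type u} [Ring S] (X : Type u) (I : Type u) [AddCommGroup I] [Module S I]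
    (hI : Module.Injective S I) : Module.Injective S (X → I) where
  out A A' _ _ _ _ f hf g := by
    choose h hh using fun x => hI.out f hf ((LinearMap.proj x).comp g)
    exact ⟨LinearMap.pi h, fun a => funext fun x => hh x a⟩

/-- A dual basis argument. With a section `s` of the free cover of `F` on its own elements, extend
each character `a ↦ g a y` along `f` to `χ y` as a mere group homomorphism, and set `h m v = ∑ χ y
(m · s v y)`; the linearity of `s` makes `h` linear. -/
theorem injective_rightDual {R : Type u} [Ring R] (F : Type u) [AddCommGroup F] [Module R F]
    [Module.Projective R F] : Module.Injective Rᵐᵒᵖ (RightDual F) where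
  out A A' _ _ _ _ f hf g := by
    obtain ⟨s, hs⟩ := Module.projective_def'.1 (inferInstance : Module.Projective R F)
    choose χ hχ using fun y : F => exists_character_extension f.toAddMonoidHom hf
      ((RightDual.eval y).comp g.toAddMonoidHom)
    let h : A' →+ (F →+ AddCircle (1 : ℚ)) := AddMonoidHom.mk' (fun m =>
      AddMonoidHom.comp (Finsupp.liftAddHom fun y : F => (χ y).comp
        (AddMonoidHom.mk' (fun r : R => MulOpposite.op r • m) fun r r' => by
          rw [MulOpposite.op_add, add_smul])) s.toAddMonoidHom) (by
      intro m m'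
      refine AddMonoidHom.ext fun v => ?_
      change (s v).sum (fun y r => χ y (MulOpposite.op r • (m + m'))) =
        (s v).sum (fun y r => χ y (MulOpposite.op r • m)) +
          (s v).sum (fun y r => χ y (MulOpposite.op r • m'))
      rw [← Finsupp.sum_add]
      simp only [smul_add, map_add])
    have h_apply : ∀ m v, h m v = (s v).sum fun y r => χ y (MulOpposite.op r • m) := fun m v => rfl
    let h' : A' →ₗ[Rᵐᵒᵖ] RightDual F :=
      { toFun := h
        map_add' := map_add h
        map_smul' := by
          intro r m
          refine RightDual.ext_eval fun v => ?_
          change h (r • m) v = h m (r.unop • v)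
          rw [h_apply, h_apply, map_smul, Finsupp.sum_smul_index (by simp)]
          refine Finsupp.sum_congr fun y _ => ?_
          rw [smul_smul, MulOpposite.op_mul, MulOpposite.op_unop] }
    refine ⟨h', fun a => RightDual.ext_eval fun v => ?_⟩
    change h (f a) v = _
    rw [h_apply]
    have hv : (s v).sum (fun y r => r • y) = v := DFunLike.congr_fun hs v
    conv_rhs => rw [← hv]
    have : ∀ w : F →₀ R, RightDual.eval (w.sum fun y r => r • y) (g a) =
        w.sum fun y r => RightDual.eval (r • y) (g a) := by
      intro w
      exact map_finsuppSum (show F →+ AddCircle (1 : ℚ) from g a) w _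
    rw [this]
    refine Finsupp.sum_congr fun y _ => ?_
    rw [← map_smul, ← RightDual.eval_smul, ← map_smul]
    exact hχ y _

/-! ### Free differential modules

A differential on the free module `B →₀ R` is given by its rows `D b`, `b : B`. -/

section Boundary

variable {R : Type u} [Ring R] {B : Type u}

/-- `c` vanishes outside `S`. -/
def Supp {J : Type u} [Zero J] (c : B → J) (S : Set B) : Prop := ∀ b, b ∉ S → c b = 0

variable {J : Type u} [AddCommGroup J] [Module Rᵐᵒᵖ J]

/-- The row vector `j • v` for `j : J` and a row vector `v` over `R`. -/
noncomputable def act (j : J) : (B →₀ R) →+ (B →₀ J) :=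
  Finsupp.mapRange.addMonoidHom
    (AddMonoidHom.mk' (fun r : R => MulOpposite.op r • j) fun r s => by
      rw [MulOpposite.op_add, add_smul])

theorem act_apply (j : J) (v : B →₀ R) (b : B) : act j v b = MulOpposite.op (v b) • j := rfl

theorem act_single (j : J) (b : B) (r : R) :
    act j (Finsupp.single b r) = Finsupp.single b (MulOpposite.op r • j) :=
  Finsupp.mapRange_single (hf := by simp)

theorem act_smul (j : J) (r : R) (v : B →₀ R) : act j (r • v) = act (MulOpposite.op r • j) v := by
  ext b
  simp [act_apply, smul_smul]

theorem act_add (j j' : J) (v : B →₀ R) : act (j + j') v = act j v + act j' v := by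
  ext b
  simp [act_apply]

/-- The map `J ⊗ D` on row vectors over `J`. -/
noncomputable def bd (D : B → B →₀ R) : (B →₀ J) →+ (B →₀ J) :=
  Finsupp.liftAddHom fun b => AddMonoidHom.mk' (fun j : J => act j (D b)) fun j j' => act_add j j' _

variable (D : B → B →₀ R)

theorem bd_single (b : B) (j : J) : bd D (Finsupp.single b j) = act j (D b) :=
  Finsupp.liftAddHom_apply_single _ _ _

theorem bd_apply (c : B →₀ J) (t : B) :
    bd D c t = c.sum fun b j => MulOpposite.op (D b t) • j := by
  change (c.sum fun b j => act j (D b)) t = _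
  rw [Finsupp.sum_apply]
  rfl

theorem bd_act (j : J) (v : B →₀ R) : bd D (act j v) = act j (Finsupp.linearCombination R D v) := by
  induction v using Finsupp.induction_linear with
  | zero => simp
  | add v w hv hw => simp only [map_add, hv, hw]
  | single b r => rw [act_single, bd_single, Finsupp.linearCombination_single, act_smul]

theorem bd_bd (hD : ∀ b, Finsupp.linearCombination R D (D b) = 0) (c : B →₀ J) :
    bd D (bd D c) = 0 := by
  induction c using Finsupp.induction_linear with
  | zero => simp
  | add v w hv hw => simp only [map_add, hv, hw, add_zero]
  | single b r => rw [bd_single, bd_act, hD, map_zero]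

theorem Supp.bd {c : B →₀ J} {S S' : Set B} (hc : Supp c S)
    (h : ∀ b ∈ S, ∀ t, t ∉ S' → D b t = 0) : Supp (bd D c) S' := by
  intro t ht
  rw [bd_apply]
  refine Finset.sum_eq_zero fun b hb => ?_
  have hbS : b ∈ S := by
    by_contra hbS
    exact Finsupp.mem_support_iff.1 hb (hc b hbS)
  simp [h b hbS t ht]

end Boundary

/-! ### Pairing with characters, and solvability of finite linear systems -/

section Pairing

variable {R : Type u} [Ring R] {B F : Type u} [AddCommGroup F] [Module R F]

/-- The pairing of a row vector of characters of `F` with a column vector over `F`. -/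
noncomputable def pair (h : B → F) : (B →₀ RightDual F) →+ AddCircle (1 : ℚ) :=
  Finsupp.liftAddHom fun b => RightDual.eval (h b)

theorem pair_single (h : B → F) (b : B) (χ : RightDual F) :
    pair h (Finsupp.single b χ) = RightDual.eval (h b) χ :=
  Finsupp.liftAddHom_apply_single _ _ _

theorem pair_congr {h h' : B → F} {c : B →₀ RightDual F} {S : Set B} (hc : Supp c S)
    (hh : ∀ b ∈ S, h b = h' b) : pair h c = pair h' c := by
  refine Finset.sum_congr rfl fun b hb => ?_
  have hbS : b ∈ S := by
    by_contra hbS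
    exact Finsupp.mem_support_iff.1 hb (hc b hbS)
  simp only [hh b hbS]

theorem eval_zero_apply (χ : RightDual F) : RightDual.eval 0 χ = 0 :=
  map_zero (show F →+ AddCircle (1 : ℚ) from χ)

theorem pair_eq_zero {h : B → F} {c : B →₀ RightDual F} {S : Set B} (hc : Supp c S)
    (hh : ∀ b ∈ S, h b = 0) : pair h c = 0 := by
  rw [pair_congr (h' := fun _ => 0) hc hh]
  exact Finset.sum_eq_zero fun b _ => eval_zero_apply _

theorem pair_piSingle [DecidableEq B] (b : B) (v : F) (c : B →₀ RightDual F) :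
    pair (Pi.single b v) c = RightDual.eval v (c b) := by
  induction c using Finsupp.induction_linear with
  | zero => simp
  | add v w hv hw => simp only [map_add, hv, hw, Finsupp.add_apply]
  | single b' r =>
    rw [pair_single]
    by_cases h : b' = b
    · subst h; simp
    · simp [h, eval_zero_apply, Finsupp.single_eq_of_ne (Ne.symm h)]

theorem pair_act (h : B → F) (χ : RightDual F) (v : B →₀ R) :
    pair h (act χ v) = RightDual.eval (Finsupp.linearCombination R h v) χ := by
  induction v using Finsupp.induction_linear with
  | zero => simp [eval_zero_apply]
  | add v w hv hw => simp only [map_add, hv, hw, RightDual.eval_add, AddMonoidHom.add_apply]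
  | single b r =>
    rw [act_single, pair_single, Finsupp.linearCombination_single, RightDual.eval_smul]

/-- Adjointness of `h ↦ h ∘ D` and the boundary on character vectors: it turns statements about
cycles over `F⁺` into solvability conditions over `F`. -/
theorem pair_bd (D : B → B →₀ R) (h : B → F) (c : B →₀ RightDual F) :
    pair h (bd D c) = pair (fun b => Finsupp.linearCombination R h (D b)) c := by
  induction c using Finsupp.induction_linear with
  | zero => simp
  | add v w hv hw => simp only [map_add, hv, hw]
  | single b χ => rw [bd_single, pair_act, pair_single]

/-- A finite system of linear equations over `F` for the values of `h : B → F` is solvable as soon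
as every character satisfies the corresponding compatibility condition. -/
theorem exists_extension_of_orthogonal (D : B → B →₀ R) (C' : Set B) (S T : Finset B)
    (w φ : B → F)
    (H : ∀ c e : B →₀ RightDual F, Supp c (S : Set B) → Supp e (T : Set B) →
      Supp (c + bd D e) C' → pair w c + pair φ e = 0) :
    ∃ h : B → F, (∀ b ∈ C', h b = 0) ∧ (∀ b ∈ S, h b = w b) ∧
      ∀ b ∈ T, Finsupp.linearCombination R h (D b) = φ b := by
  classical
  let res (U : Finset B) : (B → F) →+ (B →₀ F) :=
    AddMonoidHom.mk' (fun h => ∑ b ∈ U, Finsupp.single b (h b)) fun h h' => by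
      simp [Finset.sum_add_distrib]
  have res_apply : ∀ U h, ∀ b ∈ U, res U h b = h b := by
    intro U h b hb
    change (∑ b ∈ U, Finsupp.single b (h b)) b = h b
    rw [Finsupp.finsetSum_apply]
    rw [Finset.sum_eq_single_of_mem b hb]
    · simp
    · intro b' _ hb'
      simp [Finsupp.single_eq_of_ne (Ne.symm hb')]
  let mulD : (B → F) →+ (B → F) :=
    AddMonoidHom.mk' (fun h b => Finsupp.linearCombination R h (D b)) fun h h' => by
      funext b
      simp [Finsupp.linearCombination_apply, Finsupp.sum_add]
  let K : AddSubgroup (B → F) :=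
    { carrier := {h | ∀ b ∈ C', h b = 0}
      add_mem' := fun hx hy b hb => by simp [hx b hb, hy b hb]
      zero_mem' := fun b _ => rfl
      neg_mem' := fun hx b hb => by simp [hx b hb] }
  let Φ : (B → F) →+ (B →₀ F) × (B →₀ F) := (res S).prod ((res T).comp mulD)
  -- `Φ` records the finitely many prescribed values, so solvability is membership in the subgroup
  -- `K.map Φ`; otherwise a character separates the data from it.
  by_cases hmem : (res S w, res T φ) ∈ K.map Φ
  · obtain ⟨h, hK, hΦ⟩ := hmem
    obtain ⟨h1, h2⟩ := Prod.ext_iff.1 hΦ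
    refine ⟨h, hK, fun b hb => ?_, fun b hb => ?_⟩
    · rw [← res_apply S h b hb, ← res_apply S w b hb]
      exact DFunLike.congr_fun h1 b
    · rw [← res_apply T φ b hb]
      exact (res_apply T (mulD h) b hb).symm.trans (DFunLike.congr_fun h2 b)
  · exfalso
    obtain ⟨χ, hχ, hne⟩ := exists_character_ne_zero _ hmem
    let tuple (ψ : (B →₀ F) →+ AddCircle (1 : ℚ)) (U : Finset B) : B →₀ RightDual F :=
      ∑ b ∈ U, Finsupp.single b (show RightDual F from ψ.comp (Finsupp.singleAddHom b))
    have tuple_supp : ∀ ψ U, Supp (tuple ψ U) (U : Set B) := by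
      intro ψ U b hb
      change (∑ b ∈ U, Finsupp.single b _) b = 0
      rw [Finsupp.finsetSum_apply]
      refine Finset.sum_eq_zero fun b' hb' => Finsupp.single_eq_of_ne ?_
      rintro rfl
      exact hb hb'
    have pair_tuple : ∀ ψ U h, pair h (tuple ψ U) = ψ (res U h) := by
      intro ψ U h
      change pair h (∑ b ∈ U, Finsupp.single b _) = ψ (∑ b ∈ U, Finsupp.single b (h b))
      rw [map_sum, map_sum]
      refine Finset.sum_congr rfl fun b _ => ?_
      rw [pair_single]
      rfl
    let c := tuple (χ.comp (AddMonoidHom.inl _ _)) S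
    let e := tuple (χ.comp (AddMonoidHom.inr _ _)) T
    have key : ∀ h k, pair h c + pair k e = χ (res S h, res T k) := by
      intro h k
      rw [pair_tuple, pair_tuple, AddMonoidHom.comp_apply, AddMonoidHom.comp_apply, ← map_add]
      simp
    refine hne ?_
    rw [← key]
    -- The components of `χ` form `c` and `e`. Functions concentrated at one `b ∉ C'` lie in `K`, so
    -- `χ` kills their images, which says that `c + bd D e` vanishes at `b`.
    refine H c e (tuple_supp _ _) (tuple_supp _ _) fun b hb => RightDual.ext_eval fun v => ?_
    rw [← pair_piSingle, map_add, pair_bd, map_zero]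
    rw [key]
    refine hχ _ ⟨Pi.single b v, fun b' hb' => Pi.single_eq_of_ne ?_ _, rfl⟩
    rintro rfl
    exact hb hb'

end Pairing

/-! ### Acyclicity with uniform control of supports -/

section Exactness

variable {R : Type u} [Ring R] {B : Type u}

/-- `Hom_R((B →₀ R, D), N)` is exact. -/
def RowHomExact (D : B → B →₀ R) (N : Type u) [AddCommGroup N] [Module R N] : Prop :=
  ∀ g : B → N, (∀ b, Finsupp.linearCombination R g (D b) = 0) →
    ∃ h : B → N, ∀ b, Finsupp.linearCombination R h (D b) = g b

theorem hom_linearCombination {J : Type u} [AddCommGroup J] [Module Rᵐᵒᵖ J] (h : B → LeftDual J)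
    (v : B →₀ R) (j : J) :
    LeftDual.hom (Finsupp.linearCombination R h v) j =
      Finsupp.liftAddHom (fun b => LeftDual.hom (h b)) (act j v) := by
  induction v using Finsupp.induction_linear with
  | zero => simp
  | add v w hv hw => simp only [map_add, AddMonoidHom.add_apply, hv, hw]
  | single b r =>
    rw [act_single, Finsupp.liftAddHom_apply_single, Finsupp.linearCombination_single,
      LeftDual.hom_smul]

/-- If `Hom_R(D, J⁺)` is exact, then so is `J ⊗ D`. -/
theorem exists_bd_eq {D : B → B →₀ R} {J : Type u} [AddCommGroup J] [Module Rᵐᵒᵖ J]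
    (hJ : RowHomExact D (LeftDual J)) (c : B →₀ J) (hc : bd D c = 0) : ∃ c', bd D c' = c := by
  by_contra hne
  obtain ⟨χ, hχ, hχc⟩ := exists_character_ne_zero (bd D : (B →₀ J) →+ _).range (a := c) hne
  have hlift : ∀ k : B → LeftDual J, (∀ b j, LeftDual.hom (k b) j = χ (Finsupp.single b j)) →
      Finsupp.liftAddHom (fun b => LeftDual.hom (k b)) = χ := by
    intro k hk
    refine Finsupp.addHom_ext fun b j => ?_
    rw [Finsupp.liftAddHom_apply_single, hk]
  -- A character killing all boundaries is a cocycle with values in `J⁺`. Writing it as `h ∘ D`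
  -- shows that it kills all cycles, in particular `c`.
  let g : B → LeftDual J := fun b => χ.comp (Finsupp.singleAddHom b)
  obtain ⟨h, hh⟩ := hJ g fun b => LeftDual.ext_hom fun j => by
    rw [hom_linearCombination, hlift g fun _ _ => rfl, ← bd_single]
    exact hχ _ ⟨_, rfl⟩
  apply hχc
  have : (Finsupp.liftAddHom fun b => LeftDual.hom (h b)).comp (bd D) = χ := by
    refine Finsupp.addHom_ext fun b j => ?_
    rw [AddMonoidHom.comp_apply, bd_single, ← hom_linearCombination, hh]
    rfl
  rw [← this, AddMonoidHom.comp_apply, hc, map_zero]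

variable (D : B → B →₀ R) (I : Type u) [AddCommGroup I] [Module Rᵐᵒᵖ I]

/-- Cycles over `I` supported in a finite part of `C` are, modulo vectors supported in `C'`,
boundaries of vectors supported in a finite part of `C` that depends only on the supports. -/
def RelAcyclic (C' C : Set B) : Prop :=
  ∀ S : Finset B, (S : Set B) ⊆ C → ∃ S' : Finset B, (S' : Set B) ⊆ C ∧
    ∀ c : B →₀ I, Supp c (S : Set B) → Supp (bd D c) C' →
      ∃ c' : B →₀ I, Supp c' (S' : Set B) ∧ Supp (bd D c' - c) C'

/-- `C` spans a submodule that is stable under the differential. -/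
def RowClosed (C : Set B) : Prop := ∀ b ∈ C, ∀ t, t ∉ C → D b t = 0

variable {D I}

theorem supp_empty_iff {J : Type u} [AddCommGroup J] (c : B →₀ J) : Supp c (∅ : Set B) ↔ c = 0 :=
  ⟨fun h => Finsupp.ext fun b => h b (Set.notMem_empty b), fun h b _ => by simp [h]⟩

theorem supp_support {J : Type u} [AddCommGroup J] (c : B →₀ J) : Supp c (c.support : Set B) :=
  fun _ hb => Finsupp.notMem_support_iff.1 hb

theorem Supp.mono {J : Type u} [Zero J] {c : B → J} {S S' : Set B} (hc : Supp c S) (h : S ⊆ S') :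
    Supp c S' := fun b hb => hc b fun hS => hb (h hS)

theorem Supp.add {J : Type u} [AddCommGroup J] {c c' : B →₀ J} {S : Set B} (hc : Supp c S)
    (hc' : Supp c' S) : Supp (c + c' : B →₀ J) S := fun b hb => by simp [hc b hb, hc' b hb]

theorem Supp.sub {J : Type u} [AddCommGroup J] {c c' : B →₀ J} {S : Set B} (hc : Supp c S)
    (hc' : Supp c' S) : Supp (c - c' : B →₀ J) S := fun b hb => by simp [hc b hb, hc' b hb]

theorem Supp.neg {J : Type u} [AddCommGroup J] {c : B →₀ J} {S : Set B} (hc : Supp c S) :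
    Supp (-c : B →₀ J) S := fun b hb => by simp [hc b hb]

theorem Supp.inter {J : Type u} [Zero J] {c : B → J} {S S' : Set B} (hc : Supp c S)
    (hc' : Supp c S') : Supp c (S ∩ S') := fun b hb => by
  by_cases h : b ∈ S
  · exact hc' b fun h' => hb ⟨h, h'⟩
  · exact hc b h

/-- Uniformity comes from one universal cycle: index a power of `I` by the set `X` of all cycles
supported in `S`, and let the `x`-th coordinate of `u` be `x`. It bounds some `u'`, whose finite
support serves every cycle at once. -/
theorem relAcyclic_univ (hI : ∀ X : Type u, RowHomExact D (LeftDual (X → I))) :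
    RelAcyclic D I ∅ Set.univ := by
  intro S _
  let X : Type u := {c : B →₀ I // Supp c (S : Set B) ∧ bd D c = 0}
  have bd_eval : ∀ (c : B →₀ (X → I)) (x : X),
      bd D (c.mapRange (fun f => f x) rfl) = (bd D c).mapRange (fun f => f x) rfl := by
    intro c x
    induction c using Finsupp.induction_linear with
    | zero => simp
    | add v w hv hw => rw [Finsupp.mapRange_add (by simp), map_add, hv, hw, map_add,
        Finsupp.mapRange_add (by simp)]
    | single b f =>
      rw [Finsupp.mapRange_single, bd_single, bd_single]
      ext t
      simp [act_apply]
  let u : B →₀ (X → I) := Finsupp.onFinset S (fun b x => x.1 b) fun b hb => by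
    by_contra hbS
    exact hb (funext fun x => x.2.1 b hbS)
  have hu : ∀ x : X, u.mapRange (fun f => f x) rfl = x.1 := fun x => Finsupp.ext fun b => rfl
  have hbu : bd D u = 0 := by
    refine Finsupp.ext fun b => funext fun x => ?_
    have h := bd_eval u x
    rw [hu, x.2.2] at h
    exact (DFunLike.congr_fun h b).symm
  obtain ⟨u', hu'⟩ := exists_bd_eq (hI X) u hbu
  refine ⟨u'.support, Set.subset_univ _, fun c hc hbc => ?_⟩
  let x : X := ⟨c, hc, (supp_empty_iff _).1 hbc⟩
  refine ⟨u'.mapRange (fun f => f x) rfl, fun b hb => ?_, ?_⟩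
  · have : u' b = 0 := Finsupp.notMem_support_iff.1 hb
    rw [Finsupp.mapRange_apply, this]
    rfl
  · rw [supp_empty_iff, bd_eval, hu', hu, sub_self]

/-- The long exact sequence argument, with supports tracked. A relative cycle `c` has its boundary
in `C`, where it equals `bd D e`; then `c - e` is an absolute cycle. Rows are finitely supported, so
the support bounds depend only on `S`. -/
theorem RelAcyclic.quotient (hD : ∀ b, Finsupp.linearCombination R D (D b) = 0) {C : Set B}
    (hC : RelAcyclic D I ∅ C) (hU : RelAcyclic D I ∅ Set.univ) : RelAcyclic D I C Set.univ := by
  classical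
  intro S _
  obtain ⟨E, hEC, hE⟩ := hC ((S.biUnion fun b => (D b).support).filter (· ∈ C)) (by
    intro b hb
    exact (Finset.mem_filter.1 hb).2)
  obtain ⟨S', -, hS'⟩ := hU (S ∪ E) (Set.subset_univ _)
  refine ⟨S', Set.subset_univ _, fun c hc hbc => ?_⟩
  have h1 : Supp (bd D c) ((S.biUnion fun b => (D b).support : Finset B) : Set B) :=
    hc.bd D fun b hb t ht => by
      by_contra h
      exact ht (Finset.mem_coe.2 (Finset.mem_biUnion.2 ⟨b, hb, Finsupp.mem_support_iff.2 h⟩))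
  obtain ⟨e, he, hbe⟩ := hE (bd D c) ((h1.inter hbc).mono fun b hb =>
    Finset.mem_coe.2 (Finset.mem_filter.2 hb)) (by rw [supp_empty_iff, bd_bd D hD])
  rw [supp_empty_iff, sub_eq_zero] at hbe
  obtain ⟨c', hc', hbc'⟩ := hS' (c - e) ((hc.mono (by simp)).sub (he.mono (by simp)))
    (by rw [supp_empty_iff, map_sub, hbe, sub_self])
  rw [supp_empty_iff, sub_eq_zero] at hbc'
  refine ⟨c', hc', ?_⟩
  rw [hbc', sub_sub_cancel_left]
  exact (he.mono hEC).neg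

/-- Extensions of acyclic subquotients are acyclic. -/
theorem RelAcyclic.union (hD : ∀ b, Finsupp.linearCombination R D (D b) = 0) {C A : Set B}
    (hCc : RowClosed D C) (hC : RelAcyclic D I ∅ C) (hA : RelAcyclic D I C A) :
    RelAcyclic D I ∅ (C ∪ A) := by
  classical
  intro S hS
  -- The part of a cycle in `A` is first bounded modulo `C`; the remainder is then a cycle in `C`,
  -- with support in a finite set determined by `S` and `S₁`.
  obtain ⟨S₁, hS₁A, hS₁⟩ := hA (S.filter (· ∈ A)) fun b hb => (Finset.mem_filter.1 hb).2
  obtain ⟨E, hEC, hE⟩ := hC ((S ∪ S₁.biUnion fun b => (D b).support).filter (· ∈ C)) fun b hb =>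
    (Finset.mem_filter.1 hb).2
  refine ⟨S₁ ∪ E, ?_, fun c hc hbc => ?_⟩
  · rw [Finset.coe_union]
    exact Set.union_subset (hS₁A.trans Set.subset_union_right) (hEC.trans Set.subset_union_left)
  rw [supp_empty_iff] at hbc
  have hsplit : Supp (c - c.filter (· ∈ A) : B →₀ I) C := by
    intro b hb
    rw [Finsupp.sub_apply]
    by_cases hbA : b ∈ A
    · rw [Finsupp.filter_apply_pos _ _ hbA, sub_self]
    · rw [Finsupp.filter_apply_neg _ _ hbA, sub_zero]
      refine hc b fun hbS => ?_
      exact (hS hbS).elim hb hbA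
  obtain ⟨c₁, hc₁, hbc₁⟩ := hS₁ (c.filter (· ∈ A)) (by
      intro b hb
      by_cases hbA : b ∈ A
      · rw [Finsupp.filter_apply_pos _ _ hbA]
        exact hc b fun hbS => hb (Finset.mem_coe.2 (Finset.mem_filter.2 ⟨hbS, hbA⟩))
      · exact Finsupp.filter_apply_neg _ _ hbA) (by
      have := (hsplit.bd D hCc).neg
      rwa [map_sub, hbc, zero_sub, neg_neg] at this)
  have h1 : Supp (c - bd D c₁) C := by
    have := hsplit.sub hbc₁
    rwa [sub_sub_sub_comm, sub_self, sub_zero] at this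
  have h2 : Supp (c - bd D c₁) ((S ∪ S₁.biUnion fun b => (D b).support : Finset B) : Set B) := by
    refine (hc.mono (by simp)).sub (hc₁.bd D fun b hb t ht => ?_)
    by_contra h
    exact ht (Finset.mem_coe.2 (Finset.mem_union_right _
      (Finset.mem_biUnion.2 ⟨b, hb, Finsupp.mem_support_iff.2 h⟩)))
  obtain ⟨e, he, hbe⟩ := hE (c - bd D c₁) ((h2.inter h1).mono fun b hb =>
    Finset.mem_coe.2 (Finset.mem_filter.2 hb)) (by
      rw [supp_empty_iff, map_sub, hbc, bd_bd D hD, sub_self])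
  rw [supp_empty_iff, sub_eq_zero] at hbe
  refine ⟨c₁ + e, (hc₁.mono (by simp)).add (he.mono (by simp)), ?_⟩
  rw [supp_empty_iff, map_add, hbe]
  abel

end Exactness

/-! ### Extending solutions: Mittag-Leffler and Zorn -/

section Extension

variable {R : Type u} [Ring R] {B F : Type u} [AddCommGroup F] [Module R F] {D : B → B →₀ R}

theorem linearCombination_congr {h h' : B → F} {v : B →₀ R} (hh : ∀ b, v b ≠ 0 → h b = h' b) :
    Finsupp.linearCombination R h v = Finsupp.linearCombination R h' v := by
  rw [Finsupp.linearCombination_apply, Finsupp.linearCombination_apply]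
  exact Finset.sum_congr rfl fun b hb => by simp only [hh b (Finsupp.mem_support_iff.1 hb)]

theorem linearCombination_add_fun (h h' : B → F) (v : B →₀ R) :
    Finsupp.linearCombination R (h + h') v =
      Finsupp.linearCombination R h v + Finsupp.linearCombination R h' v := by
  simp [Finsupp.linearCombination_apply, Finsupp.sum_add]

theorem linearCombination_comp_row (h : B → F) (v : B →₀ R) :
    Finsupp.linearCombination R (fun b => Finsupp.linearCombination R h (D b)) v =
      Finsupp.linearCombination R h (Finsupp.linearCombination R D v) := by
  induction v using Finsupp.induction_linear with
  | zero => simp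
  | add v w hv hw => simp only [map_add, hv, hw]
  | single b r => simp

/-- Solving `h ∘ D = f` modulo `C` on the union of an increasing sequence of finite sets by a
Mittag-Leffler argument. -/
theorem exists_solution_on_iUnion {C : Set B} (hCc : RowClosed D C)
    (hD : ∀ b, Finsupp.linearCombination R D (D b) = 0) (A : ℕ → Finset B) (hA : Monotone A)
    (hAD : ∀ n, ∀ b ∈ A n, ∀ t, D b t ≠ 0 → t ∈ A (n + 1))
    (hAσ : ∀ n, ∀ c : B →₀ RightDual F, Supp c (A n : Set B) → Supp (bd D c) C →
      ∃ c' : B →₀ RightDual F, Supp c' (A (n + 1) : Set B) ∧ Supp (bd D c' - c) C)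
    (f : B → F) (hf : ∀ b, Finsupp.linearCombination R f (D b) = 0) (hfC : ∀ b ∈ C, f b = 0) :
    ∃ h : B → F, (∀ b ∈ C, h b = 0) ∧
      ∀ n, ∀ b ∈ A n, Finsupp.linearCombination R h (D b) = f b := by
  classical
  -- Solutions on one finite stage: the obstruction pairs `f` with a relative cycle, which is a
  -- boundary modulo `C`, and `f` kills boundaries and vanishes on `C`.
  have hsol : ∀ n, ∃ h : B → F, (∀ b ∈ C, h b = 0) ∧
      ∀ b ∈ A n, Finsupp.linearCombination R h (D b) = f b := by
    intro n
    obtain ⟨h, h1, -, h2⟩ := exists_extension_of_orthogonal D C ∅ (A n) 0 f (by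
      intro c e hc he hce
      rw [Finset.coe_empty, supp_empty_iff] at hc
      rw [hc, zero_add] at hce
      obtain ⟨e', -, he'⟩ := hAσ n e he hce
      have h0 := pair_eq_zero he' hfC
      rw [map_sub, pair_bd, sub_eq_zero] at h0
      rw [hc, map_zero, zero_add, ← h0]
      exact pair_eq_zero (supp_support e') fun b _ => hf b)
    exact ⟨h, h1, h2⟩
  -- The Mittag-Leffler condition: the restriction to `A n` of a homogeneous solution at stage `n +
  -- 1` extends to homogeneous solutions at every stage `k`.
  have hML : ∀ n k, ∀ h : B → F, (∀ b ∈ C, h b = 0) →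
      (∀ b ∈ A (n + 1), Finsupp.linearCombination R h (D b) = 0) →
      ∃ h' : B → F, (∀ b ∈ C, h' b = 0) ∧ (∀ b ∈ A n, h' b = h b) ∧
        ∀ b ∈ A k, Finsupp.linearCombination R h' (D b) = 0 := by
    intro n k h hhC hhA
    refine exists_extension_of_orthogonal D C (A n) (A k) h 0 fun c e hc he hce => ?_
    have hbc : Supp (bd D c) C := by
      have := hce.bd D hCc
      rwa [map_add, bd_bd D hD, add_zero] at this
    obtain ⟨c', hc', hbc'⟩ := hAσ n c hc hbc
    have h0 := pair_eq_zero hbc' hhC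
    rw [map_sub, pair_bd, sub_eq_zero, pair_eq_zero hc' fun b hb => hhA b hb] at h0
    rw [← h0, zero_add]
    exact pair_eq_zero he fun b _ => rfl
  -- An element of `Sol n` solves the equations on `A (n + 1)`, one stage ahead of the values on `A
  -- n` that the later corrections preserve.
  let Sol (n : ℕ) : Type u := {h : B → F // (∀ b ∈ C, h b = 0) ∧
    ∀ b ∈ A (n + 1), Finsupp.linearCombination R h (D b) = f b}
  have hstep : ∀ n (u : Sol n), ∃ u' : Sol (n + 1), ∀ b ∈ A n, u'.1 b = u.1 b := by
    intro n u
    obtain ⟨v, hvC, hv⟩ := hsol (n + 2)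
    have hv' : ∀ b ∈ A (n + 1), Finsupp.linearCombination R v (D b) = f b := fun b hb =>
      hv b (hA (Nat.le_succ _) hb)
    obtain ⟨h', h1, h2, h3⟩ := hML n (n + 2) (u.1 - v)
      (fun b hb => by rw [Pi.sub_apply, u.2.1 b hb, hvC b hb, sub_zero]) (fun b hb => by
        have := linearCombination_add_fun (u.1 - v) v (D b)
        rw [sub_add_cancel, u.2.2 b hb, hv' b hb] at this
        exact left_eq_add.1 (this.trans (add_comm _ _)))
    refine ⟨⟨v + h', fun b hb => ?_, fun b hb => ?_⟩, fun b hb => ?_⟩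
    · rw [Pi.add_apply, hvC b hb, h1 b hb, add_zero]
    · rw [linearCombination_add_fun, hv b hb, h3 b hb, add_zero]
    · simp [h2 b hb]
  choose next hnext using hstep
  let u : ∀ n, Sol n := fun n => Nat.rec ⟨(hsol 1).choose, (hsol 1).choose_spec⟩ next n
  have hu : ∀ n m, n ≤ m → ∀ b ∈ A n, (u m).1 b = (u n).1 b := by
    intro n m hnm
    induction m, hnm using Nat.le_induction with
    | base => exact fun _ _ => rfl
    | succ m hnm ih => exact fun b hb => (hnext m (u m) b (hA hnm hb)).trans (ih b hb)
  let h : B → F := fun b => if hb : ∃ n, b ∈ A n then (u hb.choose).1 b else 0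
  have hh : ∀ n, ∀ b ∈ A n, h b = (u n).1 b := by
    intro n b hb
    have hex : ∃ n, b ∈ A n := ⟨n, hb⟩
    have : h b = (u hex.choose).1 b := dif_pos hex
    rw [this]
    rcases le_total n hex.choose with hle | hle
    · exact hu _ _ hle b hb
    · exact (hu _ _ hle b hex.choose_spec).symm
  refine ⟨h, fun b hb => ?_, fun n b hb => ?_⟩
  · by_cases hex : ∃ n, b ∈ A n
    · obtain ⟨n, hn⟩ := hex
      rw [hh n b hn]
      exact (u n).2.1 b hb
    · exact dif_neg hex
  -- For `b ∈ A n` the row `D b` lives in `A (n + 1)`, where `h` agrees with `u (n + 1)`.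
  · rw [← (u (n + 1)).2.2 b (hA (by omega) hb)]
    exact linearCombination_congr fun t ht => hh (n + 1) t (hAD n b hb t ht)

variable (D) in
-- Close `{b₀}` under row supports and under the bounds `σ` for acyclicity modulo `C`. Each stage
-- stays finite, so the closure `U` is a countable union of finite sets to which the Mittag-Leffler
-- argument applies. It provides a correction `h`, zero on `C`, for the defect `f - g ∘ D`, and `g +
-- h` works on `C ∪ U`.
theorem exists_good_extension (hD : ∀ b, Finsupp.linearCombination R D (D b) = 0)
    (hU : RelAcyclic D (RightDual F) ∅ Set.univ) (f : B → F)
    (hf : ∀ b, Finsupp.linearCombination R f (D b) = 0) {C : Set B} (hCc : RowClosed D C)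
    (hC : RelAcyclic D (RightDual F) ∅ C) (g : B → F)
    (hg : ∀ b ∈ C, Finsupp.linearCombination R g (D b) = f b) (b₀ : B) :
    ∃ C' : Set B, C ⊆ C' ∧ b₀ ∈ C' ∧ RowClosed D C' ∧ RelAcyclic D (RightDual F) ∅ C' ∧
      ∃ g' : B → F, (∀ b ∈ C, g' b = g b) ∧
        ∀ b ∈ C', Finsupp.linearCombination R g' (D b) = f b := by
  classical
  choose σ _ hσ using hC.quotient hD hU
  let A : ℕ → Finset B := fun n => Nat.rec {b₀}
    (fun _ S => S ∪ (σ S (Set.subset_univ _) ∪ S.biUnion fun b => (D b).support)) n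
  have hAsucc : ∀ n, A (n + 1) =
      A n ∪ (σ (A n) (Set.subset_univ _) ∪ (A n).biUnion fun b => (D b).support) := fun n => rfl
  have hA : Monotone A := monotone_nat_of_le_succ fun n => by
    rw [hAsucc]
    exact Finset.subset_union_left
  have hAD : ∀ n, ∀ b ∈ A n, ∀ t, D b t ≠ 0 → t ∈ A (n + 1) := by
    intro n b hb t ht
    rw [hAsucc]
    exact Finset.mem_union_right _ (Finset.mem_union_right _
      (Finset.mem_biUnion.2 ⟨b, hb, Finsupp.mem_support_iff.2 ht⟩))
  have h0 : b₀ ∈ A 0 := Finset.mem_singleton_self _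
  clear_value A
  have hAσ : ∀ n, ∀ c : B →₀ RightDual F, Supp c (A n : Set B) → Supp (bd D c) C →
      ∃ c' : B →₀ RightDual F, Supp c' (A (n + 1) : Set B) ∧ Supp (bd D c' - c) C := by
    intro n c hc hbc
    obtain ⟨c', hc', h⟩ := hσ (A n) (Set.subset_univ _) c hc hbc
    refine ⟨c', hc'.mono ?_, h⟩
    rw [hAsucc]
    exact fun b hb => Finset.mem_union_right _ (Finset.mem_union_left _ hb)
  obtain ⟨h, hhC, hh⟩ := exists_solution_on_iUnion hCc hD A hA hAD hAσ
    (fun b => f b - Finsupp.linearCombination R g (D b)) (fun b => by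
      have := linearCombination_add_fun
        (fun b => f b - Finsupp.linearCombination R g (D b))
        (fun b => Finsupp.linearCombination R g (D b)) (D b)
      rw [linearCombination_comp_row, hD, map_zero, add_zero] at this
      rw [← this, ← hf b]
      congr 2
      funext b
      simp) (fun b hb => by rw [hg b hb, sub_self])
  let U : Set B := {b | ∃ n, b ∈ A n}
  have hrel : RelAcyclic D (RightDual F) C U := by
    intro S hS
    obtain ⟨n, hn⟩ : ∃ n, S ⊆ A n := by
      induction S using Finset.induction_on with
      | empty => exact ⟨0, Finset.empty_subset _⟩
      | insert b S _ ih =>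
        obtain ⟨n, hn⟩ := ih fun t ht => hS (by simp at ht ⊢; exact Or.inr ht)
        obtain ⟨m, hm⟩ := hS (by simp : b ∈ ((insert b S : Finset B) : Set B))
        refine ⟨max n m, fun t ht => ?_⟩
        rcases Finset.mem_insert.1 ht with rfl | ht
        · exact hA (le_max_right n m) hm
        · exact hA (le_max_left n m) (hn ht)
    exact ⟨A (n + 1), fun b hb => ⟨n + 1, hb⟩, fun c hc => hAσ n c (hc.mono (Finset.coe_subset.2 hn))⟩
  refine ⟨C ∪ U, Set.subset_union_left, Or.inr ⟨0, h0⟩, ?_,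
    hC.union hD hCc hrel, g + h, fun b hb => by simp [hhC b hb], ?_⟩
  · rintro b (hb | ⟨n, hb⟩) t ht
    · exact hCc b hb t fun h => ht (Or.inl h)
    · by_contra h
      exact ht (Or.inr ⟨n + 1, hAD n b hb t h⟩)
  · rintro b (hb | ⟨n, hb⟩)
    · rw [linearCombination_add_fun, hg b hb, linearCombination_congr (h' := 0), add_eq_left]
      · simp
      · intro t ht
        by_contra h
        exact ht (hCc b hb t fun htC => h (hhC t htC))
    · rw [linearCombination_add_fun, hh n b hb, add_sub_cancel]

/-- Over a free differential module `D`, exactness of `Hom_R(D, J⁺)` for all injective right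
modules `J` implies exactness of `Hom_R(D, F)` for all projective `F`. -/
theorem rowHomExact_of_projective (D : B → B →₀ R)
    (hD : ∀ b, Finsupp.linearCombination R D (D b) = 0)
    (hJ : ∀ (J : Type u) [AddCommGroup J] [Module Rᵐᵒᵖ J], Module.Injective Rᵐᵒᵖ J →
      RowHomExact D (LeftDual J)) (F : Type u) [AddCommGroup F] [Module R F]
    [Module.Projective R F] : RowHomExact D F := by
  intro f hf
  have hU : RelAcyclic D (RightDual F) ∅ Set.univ := relAcyclic_univ fun X =>
    hJ _ (injective_pi X _ (injective_rightDual F))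
  -- Acyclicity of the domain is part of the induction hypothesis: it makes the quotient by the
  -- domain acyclic, which the next extension needs. It passes to unions of chains because a
  -- nonempty finite set in the union lies in a single member.
  let Good : Set (Set B × (B → F)) := {p | RowClosed D p.1 ∧ RelAcyclic D (RightDual F) ∅ p.1 ∧
    ∀ b ∈ p.1, Finsupp.linearCombination R p.2 (D b) = f b}
  let r : Good → Good → Prop := fun p q => p.1.1 ⊆ q.1.1 ∧ ∀ b ∈ p.1.1, q.1.2 b = p.1.2 b
  have hr : ∀ {a b c}, r a b → r b c → r a c := fun hab hbc =>
    ⟨hab.1.trans hbc.1, fun b hb => (hbc.2 b (hab.1 hb)).trans (hab.2 b hb)⟩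
  obtain ⟨m, hm⟩ := exists_maximal_of_chains_bounded (r := r) (fun c hc => by
    classical
    have hdir : ∀ p ∈ c, ∀ q ∈ c, r p q ∨ r q p := fun p hp q hq => by
      by_cases h : p = q
      · subst h
        exact Or.inl ⟨subset_rfl, fun _ _ => rfl⟩
      · exact hc hp hq h
    let C : Set B := {b | ∃ p ∈ c, b ∈ p.1.1}
    let g : B → F := fun b => if hb : ∃ p ∈ c, b ∈ p.1.1 then hb.choose.1.2 b else 0
    have hg : ∀ p ∈ c, ∀ b ∈ p.1.1, g b = p.1.2 b := by
      intro p hp b hb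
      have hex : ∃ p ∈ c, b ∈ p.1.1 := ⟨p, hp, hb⟩
      have : g b = hex.choose.1.2 b := dif_pos hex
      rw [this]
      rcases hdir p hp _ hex.choose_spec.1 with h | h
      · exact h.2 b hb
      · exact (h.2 b hex.choose_spec.2).symm
    refine ⟨⟨(C, g), ?_, ?_, ?_⟩, fun p hp => ⟨fun b hb => ⟨p, hp, hb⟩, hg p hp⟩⟩
    · rintro b ⟨p, hp, hb⟩ t ht
      exact p.2.1 b hb t fun h => ht ⟨p, hp, h⟩
    · intro S hS
      -- The chain may be empty, so there need not be a member containing `∅`.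
      rcases S.eq_empty_or_nonempty with rfl | hne
      · refine ⟨∅, by simp, fun k hk _ => ⟨0, fun _ _ => rfl, ?_⟩⟩
        rw [Finset.coe_empty, supp_empty_iff] at hk
        rw [hk, map_zero, sub_zero, supp_empty_iff]
      · obtain ⟨p, hp, hSp⟩ : ∃ p ∈ c, (S : Set B) ⊆ p.1.1 := by
          induction hne using Finset.Nonempty.cons_induction with
          | singleton b =>
            obtain ⟨p, hp, hb⟩ := hS (by simp : b ∈ (({b} : Finset B) : Set B))
            exact ⟨p, hp, by simpa using hb⟩
          | cons b S hbS hne ih =>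
            obtain ⟨p, hp, hb⟩ := hS (by simp : b ∈ ((Finset.cons b S hbS : Finset B) : Set B))
            obtain ⟨q, hq, hSq⟩ := ih fun t ht => hS (by simp at ht ⊢; exact Or.inr ht)
            rw [Finset.coe_cons]
            rcases hdir p hp q hq with h | h
            · exact ⟨q, hq, Set.insert_subset (h.1 hb) hSq⟩
            · exact ⟨p, hp, Set.insert_subset hb (hSq.trans h.1)⟩
        obtain ⟨S', hS', h⟩ := p.2.2.1 S hSp
        exact ⟨S', fun b hb => ⟨p, hp, hS' hb⟩, h⟩
    · rintro b ⟨p, hp, hb⟩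
      rw [← p.2.2.2 b hb]
      refine linearCombination_congr fun t ht => hg p hp t ?_
      by_contra h
      exact ht (p.2.1 b hb t h)) hr
  refine ⟨m.1.2, fun b => m.2.2.2 b ?_⟩
  obtain ⟨C', hCC', hb, h1, h2, g', hg', h3⟩ :=
    exists_good_extension D hD hU f hf m.2.1 m.2.2.1 m.1.2 m.2.2.2 b
  exact (hm ⟨(C', g'), h1, h2, h3⟩ ⟨hCC', hg'⟩).1 hb

end Extension

/-! ### From projective to free differential modules -/

section Swindle

variable {R : Type u} [Ring R] {T : Type u} [AddCommGroup T] [Module R T]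

/-- `Hom_R((T, d), N)` is exact. -/
def EndHomExact (d : T →ₗ[R] T) (N : Type u) [AddCommGroup N] [Module R N] : Prop :=
  ∀ g : T →ₗ[R] N, g ∘ₗ d = 0 → ∃ h : T →ₗ[R] N, h ∘ₗ d = g

/-- The exactness criterion of `rowHomExact_of_projective` for a projective differential module:
adding contractible summands makes it free. -/
theorem endHomExact_of_projective [Module.Projective R T] (d : T →ₗ[R] T) (hd : d ∘ₗ d = 0)
    (hJ : ∀ (J : Type u) [AddCommGroup J] [Module Rᵐᵒᵖ J], Module.Injective Rᵐᵒᵖ J →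
      EndHomExact d (LeftDual J)) (F : Type u) [AddCommGroup F] [Module R F]
    [Module.Projective R F] : EndHomExact d F := by
  classical
  obtain ⟨s, hs⟩ := Module.projective_def'.1 (inferInstance : Module.Projective R T)
  set π : (T →₀ R) →ₗ[R] T := Finsupp.linearCombination R id with hπ
  have πs : ∀ x, π (s x) = x := fun x => DFunLike.congr_fun hs x
  have πsingle : ∀ x, π (Finsupp.single x 1) = x := fun x => by simp [hπ]
  have dd : ∀ x, d (d x) = 0 := fun x => DFunLike.congr_fun hd x
  let lv (k : ℕ) : (T →₀ R) →ₗ[R] (ℕ × T →₀ R) := Finsupp.lmapDomain R R fun x => (k, x)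
  have lv_single : ∀ k x r, lv k (Finsupp.single x r) = Finsupp.single (k, x) r := fun k x r =>
    Finsupp.mapDomain_single
  -- Each layer `k` is the free module `T →₀ R`, split by `s ∘ π` into a copy of `T` and `ker π`.
  -- Even layers send their `ker π` to the next layer, odd layers their `T`; these pairs are
  -- contractible. Only the `T` of layer `0` is left over, and `δ` puts `d` on it.
  let e (k : ℕ) : (T →₀ R) →ₗ[R] (T →₀ R) :=
    if Even k then LinearMap.id - s ∘ₗ π else s ∘ₗ π
  have e_even : ∀ k, Even k → ∀ v, e k v = v - s (π v) := fun k hk v => by simp [e, hk]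
  have e_odd : ∀ k, ¬ Even k → ∀ v, e k v = s (π v) := fun k hk v => by simp [e, hk]
  let δ (k : ℕ) : (T →₀ R) →ₗ[R] (T →₀ R) := if k = 0 then s ∘ₗ d ∘ₗ π else 0
  have δ_zero : ∀ v, δ 0 v = s (d (π v)) := fun v => by simp [δ]
  have δ_succ : ∀ k v, δ (k + 1) v = 0 := fun k v => by simp [δ]
  let D : ℕ × T → ℕ × T →₀ R := fun b =>
    lv (b.1 + 1) (e b.1 (Finsupp.single b.2 1)) + lv 0 (δ b.1 (Finsupp.single b.2 1))
  have lc_lv : ∀ {N : Type u} [AddCommGroup N] [Module R N] (g : ℕ × T → N) (k : ℕ) v,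
      Finsupp.linearCombination R g (lv k v) = Finsupp.linearCombination R (fun x => g (k, x)) v :=
    fun g k v => Finsupp.linearCombination_mapDomain ..
  have ext1 : ∀ {N : Type u} [AddCommGroup N] [Module R N] (φ ψ : (T →₀ R) →ₗ[R] N),
      (∀ x, φ (Finsupp.single x 1) = ψ (Finsupp.single x 1)) → ∀ v, φ v = ψ v := by
    intro N _ _ φ ψ h v
    have : φ = ψ := Finsupp.lhom_ext' fun x => LinearMap.ext_ring (h x)
    rw [this]
  have lcD : ∀ k v, Finsupp.linearCombination R D (lv k v) = lv (k + 1) (e k v) + lv 0 (δ k v) :=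
    fun k => ext1 (Finsupp.linearCombination R D ∘ₗ lv k) (lv (k + 1) ∘ₗ e k + lv 0 ∘ₗ δ k)
      fun x => by simp [lv_single, D]
  have lcgD : ∀ {N : Type u} [AddCommGroup N] [Module R N] (g : ℕ × T → N) (k : ℕ) (x : T),
      Finsupp.linearCombination R g (D (k, x)) =
        Finsupp.linearCombination R (fun x => g (k + 1, x)) (e k (Finsupp.single x 1)) +
          Finsupp.linearCombination R (fun x => g (0, x)) (δ k (Finsupp.single x 1)) := by
    intro N _ _ g k x
    simp only [D, map_add, lc_lv]
  have hD : ∀ b, Finsupp.linearCombination R D (D b) = 0 := by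
    rintro ⟨k, x⟩
    simp only [D, map_add, lcD]
    have he : ∀ v, e (k + 1) (e k v) = 0 := by
      intro v
      by_cases hk : Even k
      · rw [e_odd _ (by simpa [Nat.even_add_one] using hk), e_even _ hk, map_sub, πs, sub_self,
          map_zero]
      · rw [e_even _ (by simpa [Nat.even_add_one] using hk), e_odd _ hk, πs, sub_self]
    rw [he, δ_succ]
    rcases k with _ | k
    · rw [δ_zero, e_even 0 (by simp), δ_zero, πs, dd]
      simp
    · simp [δ_succ]
  have hrow : ∀ (J : Type u) [AddCommGroup J] [Module Rᵐᵒᵖ J], Module.Injective Rᵐᵒᵖ J →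
      RowHomExact D (LeftDual J) := by
    intro J _ _ hinj g hg
    let G (k : ℕ) : (T →₀ R) →ₗ[R] LeftDual J := Finsupp.linearCombination R fun x => g (k, x)
    have hG : ∀ k v, G (k + 1) (e k v) + G 0 (δ k v) = 0 := fun k =>
      ext1 (G (k + 1) ∘ₗ e k + G 0 ∘ₗ δ k) 0 fun x => (lcgD g k x).symm.trans (hg (k, x))
    have hG0 : ∀ x, G 0 (s (d x)) = 0 := by
      intro x
      have := hG 0 (s x)
      rwa [e_even 0 (by simp), δ_zero, πs, sub_self, map_zero, zero_add] at this
    obtain ⟨q, hq⟩ := hJ J hinj (G 0 ∘ₗ s) (LinearMap.ext hG0)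
    have hq' : ∀ x, q (d x) = G 0 (s x) := fun x => DFunLike.congr_fun hq x
    -- On layer `k + 1` use `g` of layer `k`, the contracting homotopy; on layer `0` use the
    -- solution `q` for `(T, d)`. The verification uses that `e k` and `e (k + 1)` are complementary
    -- projections, together with the cocycle identity `hG`.
    let h : ℕ × T → LeftDual J := fun b => Nat.casesOn b.1 (q b.2) fun k => g (k, b.2)
    have hh0 : ∀ v, Finsupp.linearCombination R (fun x => h (0, x)) v = q (π v) :=
      ext1 _ (q ∘ₗ π) fun x => by simp [h, πsingle]
    have hGs : ∀ k x, G k (Finsupp.single x 1) = g (k, x) := fun k x => by simp [G]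
    refine ⟨h, ?_⟩
    rintro ⟨k, x⟩
    rw [lcgD, hh0, ← hGs]
    change G k _ + _ = _
    generalize (Finsupp.single x 1 : T →₀ R) = v
    rcases k with _ | k
    · rw [e_even 0 (by simp), δ_zero, πs, hq', map_sub, sub_add_cancel]
    · rw [δ_succ, map_zero, map_zero, add_zero]
      by_cases hk : Even (k + 1)
      · have := hG k v
        have hk' : ¬ Even k := by simpa [Nat.even_add_one] using hk
        rw [e_odd _ hk'] at this
        rcases k with _ | k
        · exact absurd (by simp) hk'
        · rw [δ_succ, map_zero, add_zero] at this
          rw [e_even _ hk, map_sub, this, sub_zero]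
      · have hk' : Even k := by simpa [Nat.even_add_one] using hk
        have := hG k (v - s (π v))
        rw [e_even _ hk', map_sub π, πs, sub_self, map_zero, sub_zero] at this
        rcases k with _ | k
        · rw [δ_zero, map_sub π, πs, sub_self, map_zero, map_zero, map_zero, add_zero,
            map_sub, sub_eq_zero] at this
          rw [e_odd _ hk, ← this]
        · rw [δ_succ, map_zero, add_zero, map_sub, sub_eq_zero] at this
          rw [e_odd _ hk, ← this]
  intro f hf
  have hf' : ∀ x, f (d x) = 0 := fun x => DFunLike.congr_fun hf x
  let g : ℕ × T → F := fun b => Nat.casesOn b.1 (f b.2) fun _ => 0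
  have hg0 : ∀ v, Finsupp.linearCombination R (fun x => g (0, x)) v = f (π v) :=
    ext1 _ (f ∘ₗ π) fun x => by simp [g, πsingle]
  have hg1 : ∀ k v, Finsupp.linearCombination R (fun x => g (k + 1, x)) v = 0 := fun k =>
    ext1 _ 0 fun x => by simp [g]
  obtain ⟨h, hh⟩ := rowHomExact_of_projective D hD hrow F g (by
    rintro ⟨k, x⟩
    rw [lcgD, hg1 k, hg0, zero_add]
    rcases k with _ | k
    · rw [δ_zero, πs, hf']
    · rw [δ_succ, map_zero, map_zero])
  refine ⟨Finsupp.linearCombination R (fun x => h (0, x)) ∘ₗ s, LinearMap.ext fun x => ?_⟩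
  -- Evaluation at `s x` in layer `0` isolates the summand `T`: there `e 0` vanishes and only `d`
  -- contributes.
  have key := ext1 (Finsupp.linearCombination R (fun x => h (1, x)) ∘ₗ e 0 +
    Finsupp.linearCombination R (fun x => h (0, x)) ∘ₗ δ 0) (f ∘ₗ π) (fun x => by
      rw [LinearMap.add_apply, LinearMap.comp_apply, LinearMap.comp_apply, LinearMap.comp_apply,
        πsingle]
      exact (lcgD h 0 x).symm.trans (hh (0, x))) (s x)
  simp only [LinearMap.add_apply, LinearMap.comp_apply] at key
  rw [e_even 0 (by simp), δ_zero, πs, sub_self, map_zero, zero_add] at key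
  exact key

end Swindle

/-! ### The total differential module of a complex -/

namespace AcyclicProjComplex

variable {R : Type u} [Ring R] (C : AcyclicProjComplex R)

theorem d_d (n : ℤ) (x : C.X (n + 1 + 1)) : C.d n (C.d (n + 1) x) = 0 :=
  (C.exact n _).2 ⟨x, rfl⟩

theorem homAcyclic_iff (N : Type u) [AddCommGroup N] [Module R N] : C.HomAcyclic N ↔
    ∀ (n : ℤ) (g : C.X (n + 1) →ₗ[R] N), g ∘ₗ C.d (n + 1) = 0 →
      ∃ h : C.X n →ₗ[R] N, h ∘ₗ C.d n = g := by
  refine forall_congr' fun n => ⟨fun H g hg => (H g).1 hg, fun H g => ⟨H g, ?_⟩⟩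
  rintro ⟨h, rfl⟩
  ext x
  simp [C.d_d]

/-- The total differential on the direct sum of all terms. -/
noncomputable def totalD : (Π₀ n, C.X n) →ₗ[R] (Π₀ n, C.X n) where
  toFun x := (DFinsupp.comapDomain (fun n : ℤ => n + 1) (add_left_injective 1) x).mapRange
    (fun n => C.d n) fun n => map_zero _
  map_add' x y := by
    ext n
    simp
  map_smul' r x := by
    ext n
    simp

theorem totalD_apply (x : Π₀ n, C.X n) (n : ℤ) : C.totalD x n = C.d n (x (n + 1)) := by
  simp [totalD]

theorem totalD_single (n : ℤ) (x : C.X (n + 1)) :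
    C.totalD (DFinsupp.single (n + 1) x) = DFinsupp.single n (C.d n x) := by
  ext m
  rw [totalD_apply]
  by_cases h : m = n
  · subst h
    simp
  · rw [DFinsupp.single_eq_of_ne (by omega), DFinsupp.single_eq_of_ne h, map_zero]

/-- `Hom` turns the direct sum of the terms into a product, on which exactness can be checked degree
by degree. -/
theorem endHomExact_totalD_iff (N : Type u) [AddCommGroup N] [Module R N] :
    EndHomExact C.totalD N ↔ C.HomAcyclic N := by
  rw [homAcyclic_iff]
  constructor
  · intro H n g hg
    obtain ⟨h, hh⟩ := H (g ∘ₗ DFinsupp.lapply (n + 1)) (LinearMap.ext fun x => by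
      simpa [totalD_apply] using DFunLike.congr_fun hg (x (n + 1 + 1)))
    refine ⟨h ∘ₗ DFinsupp.lsingle n, LinearMap.ext fun x => ?_⟩
    have := DFunLike.congr_fun hh (DFinsupp.single (n + 1) x)
    simpa [totalD_single] using this
  · intro H g hg
    choose h hh using fun n => H n (g ∘ₗ DFinsupp.lsingle (n + 1)) (LinearMap.ext fun x => by
      have := DFunLike.congr_fun hg (DFinsupp.single (n + 1 + 1) x)
      simpa [totalD_single] using this)
    refine ⟨DFinsupp.lsum ℕ h, DFinsupp.lhom_ext fun n x => ?_⟩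
    obtain ⟨m, rfl⟩ : ∃ m, n = m + 1 := ⟨n - 1, by simp⟩
    have := DFunLike.congr_fun (hh m) x
    simpa [totalD_single] using this

end AcyclicProjComplex

/-! ### Tensor-Hom duality for complexes -/

section Duality

variable {R : Type u} [Ring R] {J : Type u} [AddCommGroup J] [Module Rᵐᵒᵖ J]
variable {P Q : Type u} [AddCommGroup P] [Module R P] [AddCommGroup Q] [Module R Q]

/-- The character of `J ⊗_R P` given by a homomorphism `P → J⁺`. -/
noncomputable def RTensor.character (g : P →ₗ[R] LeftDual J) :
    RTensor R J P →+ AddCircle (1 : ℚ) :=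
  (Submodule.liftQ (balancingRelations R J P)
    (TensorProduct.liftAddHom (LeftDual.hom.comp g.toAddMonoidHom).flip
      (by intro r m n; simp)).toIntLinearMap (by
    refine Submodule.span_le.2 ?_
    rintro _ ⟨x, r, p, rfl⟩
    simp [LeftDual.hom_smul])).toAddMonoidHom

theorem RTensor.addHom_ext {A : Type*} [AddCommGroup A] {φ ψ : RTensor R J P →+ A}
    (h : ∀ j p, φ (Submodule.Quotient.mk (j ⊗ₜ p)) = ψ (Submodule.Quotient.mk (j ⊗ₜ p))) :
    φ = ψ := by
  ext x
  obtain ⟨t, rfl⟩ := Submodule.Quotient.mk_surjective _ x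
  induction t with
  | zero => rw [Submodule.Quotient.mk_zero, map_zero, map_zero]
  | tmul j p => exact h j p
  | add s t hs ht => rw [Submodule.Quotient.mk_add, map_add, map_add, hs, ht]

/-- The homomorphism `P → J⁺` given by a character of `J ⊗_R P`. -/
noncomputable def RTensor.toDual (χ : RTensor R J P →+ AddCircle (1 : ℚ)) :
    P →ₗ[R] LeftDual J where
  toFun p := AddMonoidHom.mk' (fun j => χ (Submodule.Quotient.mk (j ⊗ₜ p))) fun j j' => by
    rw [TensorProduct.add_tmul, Submodule.Quotient.mk_add, map_add]
  map_add' p p' := LeftDual.ext_hom fun j => by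
    change χ (Submodule.Quotient.mk (j ⊗ₜ (p + p'))) =
      χ (Submodule.Quotient.mk (j ⊗ₜ p)) + χ (Submodule.Quotient.mk (j ⊗ₜ p'))
    rw [TensorProduct.tmul_add, Submodule.Quotient.mk_add, map_add]
  map_smul' r p := LeftDual.ext_hom fun j => by
    change χ (Submodule.Quotient.mk (j ⊗ₜ (r • p))) =
      χ (Submodule.Quotient.mk ((MulOpposite.op r • j) ⊗ₜ p))
    congr 1
    have h : (MulOpposite.op r • j) ⊗ₜ[ℤ] p - j ⊗ₜ[ℤ] (r • p) ∈ balancingRelations R J P :=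
      Submodule.subset_span ⟨j, r, p, rfl⟩
    exact ((Submodule.Quotient.eq _).2 h).symm

theorem exists_character_factor {A A' : Type u} [AddCommGroup A] [AddCommGroup A'] (f : A →+ A')
    (χ : A →+ AddCircle (1 : ℚ)) (h : ∀ a, f a = 0 → χ a = 0) :
    ∃ χ' : A' →+ AddCircle (1 : ℚ), ∀ a, χ' (f a) = χ a := by
  obtain ⟨χ', hχ'⟩ := exists_character_extension (QuotientAddGroup.kerLift f)
    (QuotientAddGroup.kerLift_injective f) (QuotientAddGroup.lift f.ker χ h)
  exact ⟨χ', fun a => hχ' (QuotientAddGroup.mk a)⟩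

/-- Characters of `J ⊗ P` are homomorphisms `P → J⁺`, and `ℚ/ℤ` is an injective cogenerator:
injectivity gives one direction, separation of points the other. -/
theorem AcyclicProjComplex.tensorAcyclic_iff (C : AcyclicProjComplex R) :
    C.TensorAcyclic J ↔ C.HomAcyclic (LeftDual J) := by
  rw [homAcyclic_iff]
  refine forall_congr' fun n => ⟨fun H g hg => ?_, fun H x => ⟨fun hx => ?_, ?_⟩⟩
  · obtain ⟨χ', hχ'⟩ := exists_character_factor (RTensor.map R J (C.d n)).toAddMonoidHom
      (RTensor.character g) (fun a ha => by
        obtain ⟨y, rfl⟩ := (H a).1 ha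
        have : (RTensor.character g).comp (RTensor.map R J (C.d (n + 1))).toAddMonoidHom = 0 :=
          RTensor.addHom_ext fun j p =>
            DFunLike.congr_fun (congrArg LeftDual.hom (DFunLike.congr_fun hg p)) j
        exact DFunLike.congr_fun this y)
    exact ⟨RTensor.toDual χ', LinearMap.ext fun p => LeftDual.ext_hom fun j =>
      hχ' (Submodule.Quotient.mk (j ⊗ₜ p))⟩
  · by_contra hne
    obtain ⟨χ, hχ, hχx⟩ := exists_character_ne_zero
      (RTensor.map R J (C.d (n + 1))).toAddMonoidHom.range (a := x) hne
    obtain ⟨h, hh⟩ := H (RTensor.toDual χ) (LinearMap.ext fun p => LeftDual.ext_hom fun j =>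
      hχ _ ⟨Submodule.Quotient.mk (j ⊗ₜ p), rfl⟩)
    apply hχx
    have : (RTensor.character h).comp (RTensor.map R J (C.d n)).toAddMonoidHom = χ :=
      RTensor.addHom_ext fun j p =>
        DFunLike.congr_fun (congrArg LeftDual.hom (DFunLike.congr_fun hh p)) j
    rw [← this]
    exact (congrArg (RTensor.character h) hx).trans (map_zero _)
  · rintro ⟨y, rfl⟩
    have : ((RTensor.map R J (C.d n)).comp (RTensor.map R J (C.d (n + 1)))).toAddMonoidHom = 0 :=
      RTensor.addHom_ext fun j p => by
        change Submodule.Quotient.mk (j ⊗ₜ (C.d n (C.d (n + 1) p))) = _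
        rw [C.d_d, TensorProduct.tmul_zero]
        rfl
    exact DFunLike.congr_fun this y

/-- The defining complexes of PGF-modules are complete projective resolutions. -/
theorem AcyclicProjComplex.homAcyclic_of_tensorAcyclic (C : AcyclicProjComplex R)
    (hC : ∀ (I : Type u) [AddCommGroup I] [Module Rᵐᵒᵖ I],
      Module.Injective Rᵐᵒᵖ I → C.TensorAcyclic I) (F : Type u) [AddCommGroup F] [Module R F]
    (hF : Module.Projective R F) : C.HomAcyclic F := by
  rw [← endHomExact_totalD_iff]
  have := C.projective
  refine endHomExact_of_projective C.totalD ?_ (fun J _ _ hJ => ?_) F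
  · refine LinearMap.ext fun x => DFinsupp.ext fun n => ?_
    simp [totalD_apply, C.d_d]
  · rw [endHomExact_totalD_iff, ← tensorAcyclic_iff]
    exact hC J hJ

end Duality

/-! ### Short exact sequences of modules -/

/-- `0 → A → B → C → 0` is exact. -/
structure SES {R : Type u} [Ring R] {A B C : Type u} [AddCommGroup A] [AddCommGroup B]
    [AddCommGroup C] [Module R A] [Module R B] [Module R C] (f : A →ₗ[R] B) (g : B →ₗ[R] C) :
    Prop where
  inj : Function.Injective f
  surj : Function.Surjective g
  exact : Function.Exact f g

section

variable {R : Type u} [Ring R] {A B C : Type u} [AddCommGroup A] [AddCommGroup B]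
    [AddCommGroup C] [Module R A] [Module R B] [Module R C]

/-- `C` is an extension with middle term `B`. -/
def IsExtension (R : Type u) [Ring R] (A B C : Type u) [AddCommGroup A] [AddCommGroup B]
    [AddCommGroup C] [Module R A] [Module R B] [Module R C] : Prop :=
  ∃ (f : A →ₗ[R] B) (g : B →ₗ[R] C), SES f g

theorem SES.of_injective {f : A →ₗ[R] B} (hf : Function.Injective f) :
    SES f (LinearMap.range f).mkQ :=
  ⟨hf, Submodule.mkQ_surjective _, LinearMap.exact_map_mkQ_range f⟩

theorem SES.of_surjective {g : B →ₗ[R] C} (hg : Function.Surjective g) :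
    SES (LinearMap.ker g).subtype g :=
  ⟨Subtype.val_injective, hg, g.exact_subtype_ker_map⟩

theorem SES.congr {f : A →ₗ[R] B} {g : B →ₗ[R] C} (h : SES f g) {A' B' C' : Type u}
    [AddCommGroup A'] [AddCommGroup B'] [AddCommGroup C'] [Module R A'] [Module R B'] [Module R C']
    (eA : A ≃ₗ[R] A') (eB : B ≃ₗ[R] B') (eC : C ≃ₗ[R] C') : IsExtension R A' B' C' := by
  refine ⟨eB ∘ₗ f ∘ₗ eA.symm, eC ∘ₗ g ∘ₗ eB.symm, ?_, ?_, fun b => ?_⟩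
  · exact eB.injective.comp (h.inj.comp eA.symm.injective)
  · exact eC.surjective.comp (h.surj.comp eB.symm.surjective)
  · have := h.exact (eB.symm b)
    simp only [LinearMap.coe_comp, LinearEquiv.coe_coe, Function.comp_apply,
      LinearEquiv.map_eq_zero_iff, this, Set.mem_range]
    constructor
    · rintro ⟨a, ha⟩
      exact ⟨eA a, by simp [ha]⟩
    · rintro ⟨a, rfl⟩
      exact ⟨eA.symm a, by simp⟩

theorem SES.apply_apply {f : A →ₗ[R] B} {g : B →ₗ[R] C} (h : SES f g) (a : A) : g (f a) = 0 :=
  (h.exact _).2 ⟨a, rfl⟩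

theorem exists_factor_of_surjective {N : Type u} [AddCommGroup N] [Module R N] {g : B →ₗ[R] C}
    (hg : Function.Surjective g) (φ : B →ₗ[R] N) (h : ∀ b, g b = 0 → φ b = 0) :
    ∃ ψ : C →ₗ[R] N, ∀ b, ψ (g b) = φ b := by
  refine ⟨(LinearMap.ker g).liftQ φ (fun b hb => h b hb) ∘ₗ
    (g.quotKerEquivOfSurjective hg).symm, fun b => ?_⟩
  have : (g.quotKerEquivOfSurjective hg).symm (g b) = Submodule.Quotient.mk b := by
    rw [LinearEquiv.symm_apply_eq]
    rfl
  simp only [LinearMap.comp_apply, LinearEquiv.coe_coe, this]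
  rfl

theorem exists_factor_of_injective {N : Type u} [AddCommGroup N] [Module R N] {f : A →ₗ[R] B}
    (hf : Function.Injective f) (φ : N →ₗ[R] B) (h : ∀ n, ∃ a, f a = φ n) :
    ∃ ψ : N →ₗ[R] A, ∀ n, f (ψ n) = φ n := by
  choose a ha using h
  exact ⟨{ toFun := a
           map_add' := fun x y => hf (by simp [ha])
           map_smul' := fun r x => hf (by simp [ha]) }, ha⟩

/-- For injections `A → B → D` the cokernels form a short exact sequence. -/
theorem exists_cokernel_comp {D X Z : Type u} [AddCommGroup D] [AddCommGroup X] [AddCommGroup Z]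
    [Module R D] [Module R X] [Module R Z] {f : A →ₗ[R] B} {p : B →ₗ[R] X} (h : SES f p)
    {k : B →ₗ[R] D} {q : D →ₗ[R] Z} (h' : SES k q) :
    ∃ W : ModuleCat.{u} R, IsExtension R A D W ∧ IsExtension R X W Z := by
  have hkf : Function.Injective (k ∘ₗ f) := h'.inj.comp h.inj
  have hs := SES.of_injective hkf
  have hq0 : ∀ d, (LinearMap.range (k ∘ₗ f)).mkQ d = 0 → ∃ a, k (f a) = d := fun d hd =>
    (hs.exact d).1 hd
  obtain ⟨α, hα⟩ := exists_factor_of_surjective h.surj ((LinearMap.range (k ∘ₗ f)).mkQ ∘ₗ k)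
    (fun b hb => by
      obtain ⟨a, rfl⟩ := (h.exact b).1 hb
      exact hs.apply_apply a)
  obtain ⟨β, hβ⟩ := exists_factor_of_surjective hs.surj q (fun d hd => by
      obtain ⟨a, rfl⟩ := hq0 d hd
      exact h'.apply_apply _)
  refine ⟨ModuleCat.of R (D ⧸ LinearMap.range (k ∘ₗ f)), ⟨_, _, hs⟩, α, β, ?_, ?_, ?_⟩
  · rw [injective_iff_map_eq_zero]
    intro x hx
    obtain ⟨b, rfl⟩ := h.surj x
    rw [hα] at hx
    obtain ⟨a, ha⟩ := hq0 _ hx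
    rw [← h'.inj ha]
    exact h.apply_apply a
  · intro z
    obtain ⟨d, rfl⟩ := h'.surj z
    exact ⟨_, hβ d⟩
  · intro w
    obtain ⟨d, rfl⟩ := hs.surj w
    rw [hβ]
    constructor
    · intro hd
      obtain ⟨b, rfl⟩ := (h'.exact d).1 hd
      exact ⟨p b, hα b⟩
    · rintro ⟨x, hx⟩
      obtain ⟨b, rfl⟩ := h.surj x
      rw [hα, ← sub_eq_zero, LinearMap.comp_apply, ← map_sub] at hx
      obtain ⟨a, ha⟩ := hq0 _ hx
      have : d = k (b - f a) := by rw [map_sub, ha]; abel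
      rw [this]
      exact h'.apply_apply _

/-- For surjections `D → B → C` the kernels form a short exact sequence. -/
theorem exists_kernel_comp {D K L : Type u} [AddCommGroup D] [AddCommGroup K] [AddCommGroup L]
    [Module R D] [Module R K] [Module R L] {i : K →ₗ[R] D} {p : D →ₗ[R] B} (h : SES i p)
    {j : L →ₗ[R] B} {q : B →ₗ[R] C} (h' : SES j q) :
    ∃ W : ModuleCat.{u} R, IsExtension R W D C ∧ IsExtension R K W L := by
  have hqp : Function.Surjective (q ∘ₗ p) := h'.surj.comp h.surj
  have hs := SES.of_surjective hqp
  let ι := (LinearMap.ker (q ∘ₗ p)).subtype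
  obtain ⟨α, hα⟩ := exists_factor_of_injective hs.inj i (fun n => (hs.exact _).1 (by
    rw [LinearMap.comp_apply, h.apply_apply, map_zero]))
  obtain ⟨β, hβ⟩ := exists_factor_of_injective h'.inj (p ∘ₗ ι) (fun n => (h'.exact _).1
    (hs.apply_apply n))
  refine ⟨ModuleCat.of R (LinearMap.ker (q ∘ₗ p)), ⟨_, _, hs⟩, α, β, ?_, ?_, ?_⟩
  · intro x y hxy
    exact h.inj (by rw [← hα, ← hα, hxy])
  · intro l
    obtain ⟨d, hd⟩ := h.surj (j l)
    obtain ⟨w, rfl⟩ := (hs.exact d).1 (by rw [LinearMap.comp_apply, hd, h'.apply_apply])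
    exact ⟨w, h'.inj ((hβ w).trans hd)⟩
  · intro w
    constructor
    · intro hw
      have h0 : p (ι w) = 0 := by
        have := hβ w
        rw [hw, map_zero] at this
        exact this.symm
      obtain ⟨k, hk⟩ := (h.exact _).1 h0
      exact ⟨k, hs.inj ((hα k).trans hk)⟩
    · rintro ⟨k, rfl⟩
      apply h'.inj
      rw [hβ, map_zero]
      change p ((LinearMap.ker (q ∘ₗ p)).subtype (α k)) = 0
      rw [hα, h.apply_apply]

/-- The pushout of two short exact sequences starting at `A`. -/
theorem exists_pushout {f : A →ₗ[R] B} {g : B →ₗ[R] C} (h : SES f g) {Y G : Type u}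
    [AddCommGroup Y] [AddCommGroup G] [Module R Y] [Module R G] {k : A →ₗ[R] Y} {q : Y →ₗ[R] G}
    (h' : SES k q) : ∃ E : ModuleCat.{u} R, IsExtension R Y E C ∧ IsExtension R B E G := by
  let Δ : A →ₗ[R] B × Y := f.prod (-k)
  have hΔ : Function.Injective Δ := fun a a' e => h.inj (Prod.ext_iff.1 e).1
  have hs := SES.of_injective hΔ
  let π := (LinearMap.range Δ).mkQ
  have hπ : ∀ x, π x = 0 → ∃ a, f a = x.1 ∧ -k a = x.2 := fun x hx => by
    obtain ⟨a, rfl⟩ := (hs.exact x).1 hx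
    exact ⟨a, rfl, rfl⟩
  have hπ0 : ∀ a, π (f a, 0) = π (0, k a) := fun a => by
    rw [← sub_eq_zero, ← map_sub]
    have : ((f a, 0) - (0, k a) : B × Y) = Δ a := by simp [Δ]
    rw [this]
    exact hs.apply_apply a
  have hadd : ∀ b y, π (b, y) = π (b, 0) + π (0, y) := fun b y => by
    rw [← map_add]; simp
  obtain ⟨β, hβ⟩ := exists_factor_of_surjective hs.surj (g ∘ₗ LinearMap.fst R B Y) (fun x hx => by
    obtain ⟨a, h1, -⟩ := hπ x hx
    simp [← h1, h.apply_apply])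
  obtain ⟨γ, hγ⟩ := exists_factor_of_surjective hs.surj (q ∘ₗ LinearMap.snd R B Y) (fun x hx => by
    obtain ⟨a, -, h2⟩ := hπ x hx
    simp [← h2, h'.apply_apply])
  refine ⟨ModuleCat.of R ((B × Y) ⧸ LinearMap.range Δ),
    ⟨π ∘ₗ LinearMap.inr R B Y, β, ?_, ?_, ?_⟩, π ∘ₗ LinearMap.inl R B Y, γ, ?_, ?_, ?_⟩
  · rw [injective_iff_map_eq_zero]
    intro y hy
    obtain ⟨a, h1, h2⟩ := hπ _ hy
    have ha : a = 0 := h.inj (h1.trans (map_zero f).symm)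
    have h2 : -k a = y := h2
    rw [← h2, ha, map_zero, neg_zero]
  · intro c
    obtain ⟨b, rfl⟩ := h.surj c
    exact ⟨π (b, 0), hβ (b, 0)⟩
  · intro w
    obtain ⟨⟨b, y⟩, rfl⟩ := hs.surj w
    constructor
    · intro hb
      obtain ⟨a, rfl⟩ := (h.exact b).1 ((hβ (b, y)).symm.trans hb)
      refine ⟨k a + y, ?_⟩
      change π (0, k a + y) = π (f a, y)
      rw [hadd (f a), hπ0, ← map_add]
      simp
    · rintro ⟨y', hy'⟩
      rw [← hy']
      exact (hβ (0, y')).trans (map_zero g)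
  · rw [injective_iff_map_eq_zero]
    intro b hb
    obtain ⟨a, h1, h2⟩ := hπ _ hb
    have ha : a = 0 := h'.inj (neg_eq_zero.1 h2 |>.trans (map_zero k).symm)
    have h1 : f a = b := h1
    rw [← h1, ha, map_zero]
  · intro c
    obtain ⟨y, rfl⟩ := h'.surj c
    exact ⟨π (0, y), hγ (0, y)⟩
  · intro w
    obtain ⟨⟨b, y⟩, rfl⟩ := hs.surj w
    constructor
    · intro hb
      obtain ⟨a, rfl⟩ := (h'.exact y).1 ((hγ (b, y)).symm.trans hb)
      refine ⟨b + f a, ?_⟩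
      change π (b + f a, 0) = π (b, k a)
      rw [hadd b, ← hπ0, ← map_add]
      simp
    · rintro ⟨y', hy'⟩
      rw [← hy']
      exact (hγ (y', 0)).trans (map_zero q)

/-- The pullback of two short exact sequences ending at `C`. -/
theorem exists_pullback {f : A →ₗ[R] B} {g : B →ₗ[R] C} (h : SES f g) {K P : Type u}
    [AddCommGroup K] [AddCommGroup P] [Module R K] [Module R P] {k : K →ₗ[R] P} {q : P →ₗ[R] C}
    (h' : SES k q) : ∃ E : ModuleCat.{u} R, IsExtension R A E P ∧ IsExtension R K E B := by
  let Δ : B × P →ₗ[R] C := g ∘ₗ LinearMap.fst R B P - q ∘ₗ LinearMap.snd R B P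
  let ι := (LinearMap.ker Δ).subtype
  have hmem : ∀ x : B × P, g x.1 = q x.2 → x ∈ LinearMap.ker Δ := fun x hx => by
    simp [Δ, hx]
  have hker : ∀ x : LinearMap.ker Δ, g x.1.1 = q x.1.2 := fun x => sub_eq_zero.1 x.2
  obtain ⟨α, hα⟩ := exists_factor_of_injective (f := ι) Subtype.val_injective
    (LinearMap.inl R B P ∘ₗ f) (fun a => ⟨⟨(f a, 0), hmem _ (by simp [h.apply_apply])⟩, rfl⟩)
  obtain ⟨β, hβ⟩ := exists_factor_of_injective (f := ι) Subtype.val_injective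
    (LinearMap.inr R B P ∘ₗ k) (fun a => ⟨⟨(0, k a), hmem _ (by simp [h'.apply_apply])⟩, rfl⟩)
  have hα' : ∀ a, (α a).1 = (f a, 0) := hα
  have hβ' : ∀ a, (β a).1 = (0, k a) := hβ
  refine ⟨ModuleCat.of R (LinearMap.ker Δ),
    ⟨α, LinearMap.snd R B P ∘ₗ ι, ?_, ?_, ?_⟩, β, LinearMap.fst R B P ∘ₗ ι, ?_, ?_, ?_⟩
  · intro a a' e
    have := congrArg (fun x => x.1.1) e
    simp only [hα'] at this
    exact h.inj this
  · intro p
    obtain ⟨b, hb⟩ := h.surj (q p)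
    exact ⟨⟨(b, p), hmem _ hb⟩, rfl⟩
  · rintro ⟨⟨b, p⟩, hx⟩
    constructor
    · intro hp
      have hp : p = 0 := hp
      subst hp
      obtain ⟨a, rfl⟩ := (h.exact b).1 ((hker ⟨_, hx⟩).trans (map_zero q))
      exact ⟨a, Subtype.ext (hα' a)⟩
    · rintro ⟨a, ha⟩
      rw [← ha]
      exact congrArg Prod.snd (hα' a)
  · intro a a' e
    have := congrArg (fun x => x.1.2) e
    simp only [hβ'] at this
    exact h'.inj this
  · intro b
    obtain ⟨p, hp⟩ := h'.surj (g b)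
    exact ⟨⟨(b, p), hmem _ hp.symm⟩, rfl⟩
  · rintro ⟨⟨b, p⟩, hx⟩
    constructor
    · intro hb
      have hb : b = 0 := hb
      subst hb
      obtain ⟨a, rfl⟩ := (h'.exact p).1 ((hker ⟨_, hx⟩).symm.trans (map_zero g))
      exact ⟨a, Subtype.ext (hβ' a)⟩
    · rintro ⟨a, ha⟩
      rw [← ha]
      exact congrArg Prod.fst (hβ' a)

/-- A short exact sequence with a retraction of the first map splits. -/
theorem SES.nonempty_equiv_prod {f : A →ₗ[R] B} {g : B →ₗ[R] C} (h : SES f g) (r : B →ₗ[R] A)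
    (hr : ∀ a, r (f a) = a) : Nonempty (B ≃ₗ[R] A × C) := by
  refine ⟨LinearEquiv.ofBijective (r.prod g) ⟨?_, ?_⟩⟩
  · rw [injective_iff_map_eq_zero]
    intro b hb
    obtain ⟨h1, h2⟩ := Prod.ext_iff.1 hb
    obtain ⟨a, rfl⟩ := (h.exact b).1 h2
    have h1 : r (f a) = 0 := h1
    rw [← hr a, h1, map_zero]
  · rintro ⟨a, c⟩
    obtain ⟨b, rfl⟩ := h.surj c
    refine ⟨b + f (a - r b), Prod.ext ?_ ?_⟩
    · change r (b + f (a - r b)) = a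
      rw [map_add, hr]; abel
    · change g (b + f (a - r b)) = g b
      rw [map_add, h.apply_apply, add_zero]

end

/-! ### Vanishing of Ext -/

section Ext

open CategoryTheory Abelian

variable {R : Type u} [Ring R]

/-- `Ext^i_R(M, N) = 0`. -/
def ExtZero (R : Type u) [Ring R] (M N : Type u) [AddCommGroup M] [AddCommGroup N] [Module R M]
    [Module R N] (i : ℕ) : Prop :=
  Subsingleton (Ext.{u} (ModuleCat.of R M) (ModuleCat.of R N) i)

variable {A B C : Type u} [AddCommGroup A] [AddCommGroup B]
    [AddCommGroup C] [Module R A] [Module R B] [Module R C]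

/-- The short complex of a short exact sequence. -/
abbrev SES.complex {f : A →ₗ[R] B} {g : B →ₗ[R] C} (h : SES f g) : ShortComplex (ModuleCat.{u} R) :=
  ShortComplex.mk (ModuleCat.ofHom f) (ModuleCat.ofHom g)
    (ModuleCat.hom_ext (LinearMap.ext h.apply_apply))

theorem SES.shortExact {f : A →ₗ[R] B} {g : B →ₗ[R] C} (h : SES f g) : h.complex.ShortExact :=
  ModuleCat.shortComplex_shortExact h.complex h.exact h.inj h.surj

variable {N : Type u} [AddCommGroup N] [Module R N]

theorem SES.extZero_middle {f : A →ₗ[R] B} {g : B →ₗ[R] C} (h : SES f g) {i : ℕ}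
    (hA : ExtZero R A N i) (hC : ExtZero R C N i) : ExtZero R B N i := by
  refine subsingleton_of_forall_eq 0 fun x => ?_
  obtain ⟨y, rfl⟩ := Ext.contravariant_sequence_exact₂ h.shortExact _ x (hA.elim _ _)
  rw [hC.elim y 0, Ext.comp_zero]

theorem SES.extZero_left {f : A →ₗ[R] B} {g : B →ₗ[R] C} (h : SES f g) {i : ℕ}
    (hB : ExtZero R B N i) (hC : ExtZero R C N (i + 1)) : ExtZero R A N i := by
  refine subsingleton_of_forall_eq 0 fun x => ?_
  obtain ⟨y, rfl⟩ := Ext.contravariant_sequence_exact₁ h.shortExact _ x (add_comm 1 i)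
    (hC.elim _ _)
  rw [hB.elim y 0, Ext.comp_zero]

theorem SES.extZero_right {f : A →ₗ[R] B} {g : B →ₗ[R] C} (h : SES f g) {i : ℕ}
    (hA : ExtZero R A N i) (hB : ExtZero R B N (i + 1)) : ExtZero R C N (i + 1) := by
  refine subsingleton_of_forall_eq 0 fun x => ?_
  obtain ⟨y, rfl⟩ := Ext.contravariant_sequence_exact₃ h.shortExact _ x (hB.elim _ _)
    (add_comm 1 i)
  rw [hA.elim y 0, Ext.comp_zero]

theorem projective_iff (P : Type u) [AddCommGroup P] [Module R P] :
    Module.Projective R P ↔ Projective (ModuleCat.of R P) := IsProjective.iff_projective P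

theorem extZero_of_projective (P : Type u) [AddCommGroup P] [Module R P]
    (hP : Module.Projective R P) (i : ℕ) : ExtZero R P N (i + 1) := by
  have := (projective_iff P).1 hP
  exact subsingleton_of_forall_eq 0 fun x => Ext.eq_zero_of_projective x

theorem SES.exists_extension {f : A →ₗ[R] B} {g : B →ₗ[R] C} (h : SES f g)
    (hC : ExtZero R C N 1) (φ : A →ₗ[R] N) : ∃ ψ : B →ₗ[R] N, ψ ∘ₗ f = φ := by
  obtain ⟨y, hy⟩ := Ext.contravariant_sequence_exact₁ h.shortExact _
    (Ext.mk₀ (ModuleCat.ofHom φ)) (add_comm 1 0) (hC.elim _ _)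
  obtain ⟨ψ, rfl⟩ := (Ext.mk₀_bijective _ _).2 y
  rw [Ext.mk₀_comp_mk₀] at hy
  exact ⟨ψ.hom, congrArg ModuleCat.Hom.hom ((Ext.mk₀_bijective _ _).1 hy)⟩

/-- For projective `B`, `Ext¹(C, N)` is the cokernel of `Hom(B, N) → Hom(A, N)`. -/
theorem SES.extZero_one {f : A →ₗ[R] B} {g : B →ₗ[R] C} (h : SES f g)
    (hB : Module.Projective R B) (H : ∀ φ : A →ₗ[R] N, ∃ ψ : B →ₗ[R] N, ψ ∘ₗ f = φ) :
    ExtZero R C N 1 := by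
  refine subsingleton_of_forall_eq 0 fun x => ?_
  obtain ⟨y, rfl⟩ := Ext.contravariant_sequence_exact₃ h.shortExact _ x
    ((extZero_of_projective B hB 0).elim _ _) (add_comm 1 0)
  obtain ⟨φ, rfl⟩ := (Ext.mk₀_bijective _ _).2 y
  obtain ⟨ψ, hψ⟩ := H φ.hom
  have : φ = h.complex.f ≫ ModuleCat.ofHom ψ := ModuleCat.hom_ext hψ.symm
  rw [this, ← Ext.mk₀_comp_mk₀]
  exact h.shortExact.extClass_comp_assoc _

theorem SES.nonempty_equiv_prod_of_extZero {f : A →ₗ[R] B} {g : B →ₗ[R] C} (h : SES f g)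
    (hC : ExtZero R C A 1) : Nonempty (B ≃ₗ[R] A × C) := by
  obtain ⟨r, hr⟩ := h.exists_extension hC LinearMap.id
  exact h.nonempty_equiv_prod r fun a => DFunLike.congr_fun hr a

/-- The projective dimension of `M` is at most `n`. -/
abbrev PdLE (R : Type u) [Ring R] (M : Type u) [AddCommGroup M] [Module R M] (n : ℕ) : Prop :=
  HasProjectiveDimensionLE (ModuleCat.of R M) n

theorem pdLE_zero_iff (M : Type u) [AddCommGroup M] [Module R M] :
    PdLE R M 0 ↔ Module.Projective R M := by
  rw [projective_iff, projective_iff_hasProjectiveDimensionLE_zero]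

theorem exists_projective_cover (M : Type u) [AddCommGroup M] [Module R M] :
    ∃ P K : ModuleCat.{u} R, Module.Projective R P ∧ IsExtension R K P M := by
  have hs : Function.Surjective (Finsupp.linearCombination R (id : M → M)) := fun m =>
    ⟨Finsupp.single m 1, by simp⟩
  exact ⟨ModuleCat.of R (M →₀ R), ModuleCat.of R (LinearMap.ker (Finsupp.linearCombination R id)),
    inferInstanceAs (Module.Projective R (M →₀ R)), _, _, SES.of_surjective hs⟩

/-- A finite projective dimension is detected by `Ext` into projective modules. -/
theorem pdLE_of_extZero {M : Type u} [AddCommGroup M] [Module R M] {m n : ℕ} (hn : PdLE R M n)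
    (H : ∀ (Q : Type u) [AddCommGroup Q] [Module R Q], Module.Projective R Q →
      ∀ i, m < i → ExtZero R M Q i) : PdLE R M m := by
  induction n with
  | zero => exact hasProjectiveDimensionLT_of_ge _ 1 _ (by omega)
  | succ n ih =>
    rcases le_or_gt (n + 1) m with h | h
    · exact hasProjectiveDimensionLT_of_ge _ (n + 1 + 1) _ (by omega)
    -- The bound drops by one: for a projective cover `P` of `Y` with kernel `K`, `Ext^(n+1)(M, Y)`
    -- lies between `Ext^(n+1)(M, P) = 0` and `Ext^(n+2)(M, K) = 0`.
    refine ih (HasProjectiveDimensionLT.mk fun i hi Y e => ?_)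
    rcases hi.eq_or_lt with rfl | hi
    · obtain ⟨P, K, hP, f, g, hs⟩ := exists_projective_cover (R := R) Y
      obtain ⟨y, rfl⟩ := Ext.covariant_sequence_exact₃ (ModuleCat.of R M) hs.shortExact e rfl
        (Ext.eq_zero_of_hasProjectiveDimensionLT _ (n + 1 + 1) le_rfl)
      rw [(H P hP (n + 1) h).elim y 0, Ext.zero_comp]
    · exact e.eq_zero_of_hasProjectiveDimensionLT (n + 1 + 1) hi

end Ext

/-! ### Complete syzygies relative to a class of test modules -/

section Syzygy

variable (R : Type u) [Ring R]

/-- `M` is a syzygy of an acyclic complex of projective modules that remains acyclic under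
`Hom_R(-, N)` for all `N` in the class `𝒩`. -/
def IsCompleteSyzygy (𝒩 : ∀ (N : Type u) [AddCommGroup N] [Module R N], Prop)
    (M : Type u) [AddCommGroup M] [Module R M] : Prop :=
  ∃ C : AcyclicProjComplex R,
    (∀ (N : Type u) [AddCommGroup N] [Module R N], 𝒩 N → C.HomAcyclic N) ∧ C.IsSyzygy M

variable {R} {𝒩 : ∀ (N : Type u) [AddCommGroup N] [Module R N], Prop}

theorem IsCompleteSyzygy.congr {M M' : Type u} [AddCommGroup M] [Module R M] [AddCommGroup M']
    [Module R M'] (h : IsCompleteSyzygy R 𝒩 M) (e : M ≃ₗ[R] M') : IsCompleteSyzygy R 𝒩 M' := by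
  obtain ⟨C, hC, n, ⟨e'⟩⟩ := h
  exact ⟨C, hC, n, ⟨e.symm.trans e'⟩⟩

namespace AcyclicProjComplex

variable (C : AcyclicProjComplex R)

theorem ses (n : ℤ) : SES (LinearMap.range (C.d (n + 1))).subtype (C.d n).rangeRestrict :=
  ⟨Subtype.val_injective, LinearMap.surjective_rangeRestrict _, fun x => by
    rw [← Subtype.val_inj]
    refine (C.exact n x).trans ?_
    simp⟩

/-- A map from the next syzygy to `N` is a cocycle of `Hom(C, N)`; acyclicity extends it to the
projective term, so there is no obstruction in `Ext¹`. -/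
theorem extZero_range {N : Type u} [AddCommGroup N] [Module R N] (hN : C.HomAcyclic N) (n : ℤ) :
    ExtZero R (LinearMap.range (C.d n)) N 1 := by
  refine (C.ses n).extZero_one (C.projective _) fun φ => ?_
  obtain ⟨ψ, hψ⟩ := (C.homAcyclic_iff N).1 hN (n + 1) (φ ∘ₗ (C.d (n + 1)).rangeRestrict)
    (LinearMap.ext fun x => by
      have : (C.d (n + 1)).rangeRestrict (C.d (n + 1 + 1) x) = 0 := Subtype.ext (C.d_d _ x)
      rw [LinearMap.comp_apply, LinearMap.comp_apply, this, map_zero, LinearMap.zero_apply])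
  refine ⟨ψ, LinearMap.ext ?_⟩
  rintro ⟨_, x, rfl⟩
  exact DFunLike.congr_fun hψ x

theorem isCompleteSyzygy_range
    (hC : ∀ (N : Type u) [AddCommGroup N] [Module R N], 𝒩 N → C.HomAcyclic N) (n : ℤ) :
    IsCompleteSyzygy R 𝒩 (LinearMap.range (C.d n)) :=
  ⟨C, hC, n, ⟨LinearEquiv.refl _ _⟩⟩

end AcyclicProjComplex

namespace IsCompleteSyzygy

variable {M : Type u} [AddCommGroup M] [Module R M]

theorem extZero_one (h : IsCompleteSyzygy R 𝒩 M) {N : Type u} [AddCommGroup N] [Module R N]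
    (hN : 𝒩 N) : ExtZero R M N 1 := by
  obtain ⟨C, hC, n, ⟨e⟩⟩ := h
  have := C.extZero_range (hC N hN) n
  have h : SES (0 : PUnit.{u + 1} →ₗ[R] M) (e : M →ₗ[R] LinearMap.range (C.d n)) :=
    ⟨fun _ _ _ => rfl, e.surjective, fun m => e.map_eq_zero_iff.trans
      ⟨fun h => ⟨0, h.symm⟩, fun ⟨_, h⟩ => h.symm⟩⟩
  exact h.extZero_middle (extZero_of_projective _ inferInstance 0) this

theorem exists_embedding (h : IsCompleteSyzygy R 𝒩 M) : ∃ P M' : ModuleCat.{u} R,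
    Module.Projective R P ∧ IsCompleteSyzygy R 𝒩 M' ∧ IsExtension R M P M' := by
  obtain ⟨C, hC, n, ⟨e⟩⟩ := h
  obtain ⟨n, rfl⟩ : ∃ m, n = m + 1 := ⟨n - 1, by simp⟩
  exact ⟨ModuleCat.of R (C.X (n + 1)), ModuleCat.of R (LinearMap.range (C.d n)), C.projective _,
    C.isCompleteSyzygy_range hC n,
    (C.ses n).congr e.symm (LinearEquiv.refl _ _) (LinearEquiv.refl _ _)⟩

theorem exists_cover (h : IsCompleteSyzygy R 𝒩 M) : ∃ P M' : ModuleCat.{u} R,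
    Module.Projective R P ∧ IsCompleteSyzygy R 𝒩 M' ∧ IsExtension R M' P M := by
  obtain ⟨C, hC, n, ⟨e⟩⟩ := h
  exact ⟨ModuleCat.of R (C.X (n + 1)), ModuleCat.of R (LinearMap.range (C.d (n + 1))),
    C.projective _, C.isCompleteSyzygy_range hC (n + 1),
    (C.ses n).congr (LinearEquiv.refl _ _) (LinearEquiv.refl _ _) e.symm⟩

theorem extZero_succ (h : IsCompleteSyzygy R 𝒩 M) {N : Type u} [AddCommGroup N] [Module R N]
    (hN : 𝒩 N) (i : ℕ) : ExtZero R M N (i + 1) := by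
  induction i generalizing M with
  | zero => exact h.extZero_one hN
  | succ i ih =>
    obtain ⟨P, M', hP, hM', f, g, hs⟩ := h.exists_cover
    exact hs.extZero_right (ih hM') (extZero_of_projective P hP _)

/-- A class of modules with vanishing `Ext¹` into `𝒩` that is closed under taking suitable
syzygies and cosyzygies consists of complete syzygies. -/
theorem of_class (𝒞 : ModuleCat.{u} R → Prop)
    (hExt : ∀ M, 𝒞 M → ∀ (N : Type u) [AddCommGroup N] [Module R N], 𝒩 N → ExtZero R M N 1)
    (hnext : ∀ M, 𝒞 M → ∃ P M' : ModuleCat.{u} R,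
      Module.Projective R P ∧ 𝒞 M' ∧ IsExtension R M P M')
    (hprev : ∀ M, 𝒞 M → ∃ P M' : ModuleCat.{u} R,
      Module.Projective R P ∧ 𝒞 M' ∧ IsExtension R M' P M)
    (M : ModuleCat.{u} R) (hM : 𝒞 M) : IsCompleteSyzygy R 𝒩 M := by
  let Obj := {M : ModuleCat.{u} R // 𝒞 M}
  let Step (A C : Obj) : Prop :=
    ∃ P : ModuleCat.{u} R, Module.Projective R P ∧ IsExtension R A.1 P C.1
  have hnext' : ∀ A : Obj, ∃ C : Obj, Step A C := fun A => by
    obtain ⟨P, M', h1, h2, h3⟩ := hnext A.1 A.2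
    exact ⟨⟨M', h2⟩, P, h1, h3⟩
  have hprev' : ∀ A : Obj, ∃ C : Obj, Step C A := fun A => by
    obtain ⟨P, M', h1, h2, h3⟩ := hprev A.1 A.2
    exact ⟨⟨M', h2⟩, P, h1, h3⟩
  choose next hnext' using hnext'
  choose prev hprev' using hprev'
  let M₀ : Obj := ⟨M, hM⟩
  -- `M` sits in degree `0`, with chosen syzygies in positive degrees and cosyzygies in negative
  -- ones.
  let S : ℤ → Obj := fun n => Int.rec (fun k => prev^[k] M₀) (fun k => next^[k + 1] M₀) n
  have hneg : ∀ k : ℕ, S (Int.negSucc k + 1) = next^[k] M₀ := fun k => by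
    cases k <;> rfl
  have hstep : ∀ n, Step (S (n + 1)) (S n) := by
    rintro (k | k)
    · have h1 : S (Int.ofNat k + 1) = prev (S (Int.ofNat k)) :=
        Function.iterate_succ_apply' prev k M₀
      rw [h1]
      exact hprev' _
    · have h1 : S (Int.negSucc k) = next (next^[k] M₀) := Function.iterate_succ_apply' next k M₀
      rw [hneg, h1]
      exact hnext' _
  choose P hP f g hs using hstep
  let C : AcyclicProjComplex R :=
    { X := fun n => P n
      d := fun n => f n ∘ₗ g (n + 1)
      projective := hP
      exact := fun n x => by
        have h1 : f n (g (n + 1) x) = 0 ↔ g (n + 1) x = 0 := map_eq_zero_iff _ (hs n).inj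
        refine h1.trans (((hs (n + 1)).exact x).trans ?_)
        constructor
        · rintro ⟨y, rfl⟩
          obtain ⟨z, rfl⟩ := (hs (n + 1 + 1)).surj y
          exact ⟨z, rfl⟩
        · rintro ⟨z, rfl⟩
          exact ⟨_, rfl⟩ }
  have hrange : ∀ n, LinearMap.range (C.d n) = LinearMap.range (f n) := fun n =>
    LinearMap.range_comp_of_range_eq_top _ (LinearMap.range_eq_top.2 (hs (n + 1)).surj)
  -- The image of `C.d n` is a copy of `S (n + 1)`, so `M = S 0` appears at `n = -1`.
  refine ⟨C, fun N _ _ hN => (C.homAcyclic_iff N).2 fun n φ hφ => ?_, -1, ?_⟩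
  · have h0 : ∀ y, φ (f (n + 1) y) = 0 := fun y => by
      obtain ⟨z, rfl⟩ := (hs (n + 1 + 1)).surj y
      exact DFunLike.congr_fun hφ z
    obtain ⟨φ', hφ'⟩ := exists_factor_of_surjective (hs (n + 1)).surj φ fun b hb => by
      obtain ⟨y, rfl⟩ := ((hs (n + 1)).exact b).1 hb
      exact h0 y
    obtain ⟨ψ, hψ⟩ := (hs n).exists_extension (hExt _ (S n).2 N hN) φ'
    refine ⟨ψ, LinearMap.ext fun x => ?_⟩
    rw [← hφ', ← hψ]
    rfl
  · rw [hrange]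
    exact ⟨LinearEquiv.ofInjective (f (-1)) (hs (-1)).inj⟩

theorem of_projective {P : Type u} [AddCommGroup P] [Module R P] (hP : Module.Projective R P) :
    IsCompleteSyzygy R 𝒩 P := by
  refine of_class (fun M => Module.Projective R M) (fun M hM N _ _ _ =>
    extZero_of_projective M hM 0) (fun M hM => ?_) (fun M hM => ?_) (ModuleCat.of R P) hP
  · exact ⟨M, ModuleCat.of R PUnit.{u + 1}, hM, inferInstanceAs (Module.Projective R PUnit.{u + 1}),
      LinearMap.id, 0, Function.injective_id, fun _ => ⟨0, rfl⟩, fun m => by simp⟩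
  · exact ⟨M, ModuleCat.of R PUnit.{u + 1}, hM, inferInstanceAs (Module.Projective R PUnit.{u + 1}),
      0, LinearMap.id, fun _ _ _ => rfl, Function.surjective_id, fun m => by simp [eq_comm]⟩

variable (h𝒩 : ∀ (Q : Type u) [AddCommGroup Q] [Module R Q], Module.Projective R Q → 𝒩 Q)
include h𝒩

/-- A horseshoe argument on the class of all such extensions. For cosyzygies, push out along an
embedding `A → P`: the result is an extension of `C` by `P`, which splits since `P` is a test
module, hence embeds in `P × Q`, and the cokernel of `B → P × Q` is again an extension. For
syzygies, pull back along a projective cover of `C`. -/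
theorem of_isExtension {A B C : Type u} [AddCommGroup A] [AddCommGroup B]
    [AddCommGroup C] [Module R A] [Module R B] [Module R C] (hA : IsCompleteSyzygy R 𝒩 A)
    (hC : IsCompleteSyzygy R 𝒩 C) (h : IsExtension R A B C) : IsCompleteSyzygy R 𝒩 B := by
  refine of_class (fun B => ∃ A C : ModuleCat.{u} R, IsCompleteSyzygy R 𝒩 A ∧
    IsCompleteSyzygy R 𝒩 C ∧ IsExtension R A B C) ?_ ?_ ?_ (ModuleCat.of R B)
    ⟨ModuleCat.of R A, ModuleCat.of R C, hA, hC, h⟩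
  · rintro B ⟨A, C, hA, hC, f, g, h⟩ N _ _ hN
    exact h.extZero_middle (hA.extZero_one hN) (hC.extZero_one hN)
  · rintro B ⟨A, C, hA, hC, f, g, h⟩
    obtain ⟨P, A', hP, hA', i, p, hi⟩ := hA.exists_embedding
    obtain ⟨Q, C', hQ, hC', j, q, hj⟩ := hC.exists_embedding
    obtain ⟨E, ⟨a, b, hE⟩, c, d, hE'⟩ := exists_pushout h hi
    obtain ⟨e⟩ := hE.nonempty_equiv_prod_of_extZero (hC.extZero_one (h𝒩 P hP))
    have hPQ : SES (LinearMap.prodMap LinearMap.id j : P × C →ₗ[R] P × Q)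
        (q ∘ₗ LinearMap.snd R P Q) := by
      refine ⟨fun x y hxy => ?_, hj.surj.comp Prod.snd_surjective, fun x => ?_⟩
      · obtain ⟨h1, h2⟩ := Prod.ext_iff.1 hxy
        exact Prod.ext h1 (hj.inj h2)
      · refine (hj.exact x.2).trans ⟨?_, ?_⟩
        · rintro ⟨c, hc⟩
          exact ⟨(x.1, c), Prod.ext rfl hc⟩
        · rintro ⟨y, rfl⟩
          exact ⟨y.2, rfl⟩
    obtain ⟨_, _, hs⟩ := hPQ.congr e.symm (LinearEquiv.refl R _) (LinearEquiv.refl R _)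
    obtain ⟨W, hW, hW'⟩ := exists_cokernel_comp hE' hs
    exact ⟨ModuleCat.of R (P × Q), W, inferInstanceAs (Module.Projective R (P × Q)),
      ⟨A', C', hA', hC', hW'⟩, hW⟩
  · rintro B ⟨A, C, hA, hC, f, g, h⟩
    obtain ⟨P, A', hP, hA', i, p, hi⟩ := hA.exists_cover
    obtain ⟨Q, C', hQ, hC', j, q, hj⟩ := hC.exists_cover
    obtain ⟨E, ⟨a, b, hE⟩, c, d, hE'⟩ := exists_pullback h hj
    obtain ⟨e⟩ := hE.nonempty_equiv_prod_of_extZero (extZero_of_projective Q hQ 0)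
    have hPQ : SES (LinearMap.inl R P Q ∘ₗ i)
        (LinearMap.prodMap p LinearMap.id : P × Q →ₗ[R] A × Q) := by
      refine ⟨LinearMap.inl_injective.comp hi.inj, fun x => ?_, fun x => ?_⟩
      · obtain ⟨y, hy⟩ := hi.surj x.1
        exact ⟨(y, x.2), Prod.ext hy rfl⟩
      · constructor
        · intro hx
          obtain ⟨h1, h2⟩ := Prod.ext_iff.1 hx
          obtain ⟨a, ha⟩ := (hi.exact x.1).1 h1
          exact ⟨a, Prod.ext ha h2.symm⟩
        · rintro ⟨a, rfl⟩
          exact Prod.ext (hi.apply_apply a) rfl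
    obtain ⟨_, _, hs⟩ := hPQ.congr (LinearEquiv.refl R _) (LinearEquiv.refl R _) e.symm
    obtain ⟨W, hW, hW'⟩ := exists_kernel_comp hs hE'
    exact ⟨ModuleCat.of R (P × Q), W, inferInstanceAs (Module.Projective R (P × Q)),
      ⟨A', C', hA', hC', hW'⟩, hW⟩

/-- Composing `K → Y × K` with an embedding into a projective gives a cosyzygy that is an extension
of complete syzygies. Composing a cover `P → Y × K` with the projection to `Y` leaves a kernel that
is projective, because `Y` is, and covers `K`. Both new modules are complete syzygies, so their
projective complement is zero. -/
theorem of_prod_projective {Y K : Type u} [AddCommGroup Y] [AddCommGroup K] [Module R Y]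
    [Module R K] (hY : Module.Projective R Y) (h : IsCompleteSyzygy R 𝒩 (Y × K)) :
    IsCompleteSyzygy R 𝒩 K := by
  have hs : ∀ (Y K : Type u) [AddCommGroup Y] [AddCommGroup K] [Module R Y] [Module R K],
      SES (LinearMap.inr R Y K) (LinearMap.fst R Y K) := fun Y K _ _ _ _ =>
    ⟨LinearMap.inr_injective, LinearMap.fst_surjective, Function.Exact.inr_fst⟩
  refine of_class (fun K => ∃ Y : ModuleCat.{u} R, Module.Projective R Y ∧
    IsCompleteSyzygy R 𝒩 (Y × K)) ?_ ?_ ?_ (ModuleCat.of R K) ⟨ModuleCat.of R Y, hY, h⟩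
  · rintro K ⟨Y, hY, h⟩ N _ _ hN
    exact (hs Y K).extZero_left (h.extZero_one hN) (extZero_of_projective Y hY 1)
  · rintro K ⟨Y, hY, h⟩
    obtain ⟨P, M', hP, hM', f, g, h'⟩ := h.exists_embedding
    obtain ⟨W, hW, hW'⟩ := exists_cokernel_comp (hs Y K) h'
    refine ⟨P, W, hP, ⟨ModuleCat.of R PUnit.{u + 1}, inferInstanceAs (Module.Projective R PUnit.{u + 1}),
      ?_⟩, hW⟩
    exact of_isExtension h𝒩 (of_projective (P := PUnit.{u + 1}) inferInstance)
      (of_isExtension h𝒩 (of_projective hY) hM' hW') ⟨LinearMap.inl R _ _, LinearMap.snd R _ _,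
        LinearMap.inl_injective, LinearMap.snd_surjective, Function.Exact.inl_snd⟩
  · rintro K ⟨Y, hY, h⟩
    obtain ⟨P, M', hP, hM', f, g, h'⟩ := h.exists_cover
    obtain ⟨W, ⟨a, b, hW⟩, hW'⟩ := exists_kernel_comp h' (hs Y K)
    have hWproj : Module.Projective R W := by
      rw [← pdLE_zero_iff]
      have := (pdLE_zero_iff (R := R) Y).2 hY
      exact hW.shortExact.hasProjectiveDimensionLT_X₁ 1
        ((pdLE_zero_iff (R := R) P).2 hP)
        (CategoryTheory.hasProjectiveDimensionLT_of_ge _ 1 _ (by omega))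
    refine ⟨W, M', hWproj, ⟨ModuleCat.of R PUnit.{u + 1},
      inferInstanceAs (Module.Projective R PUnit.{u + 1}), ?_⟩, hW'⟩
    exact of_isExtension h𝒩 (of_projective (P := PUnit.{u + 1}) inferInstance) hM'
      ⟨LinearMap.inl R _ _, LinearMap.snd R _ _,
        LinearMap.inl_injective, LinearMap.snd_surjective, Function.Exact.inl_snd⟩

end IsCompleteSyzygy

end Syzygy

/-! ### Finite resolutions and the dimensions they define -/

section Resolutions

variable (R : Type u) [Ring R] (𝒢 : ∀ (G : Type u) [AddCommGroup G] [Module R G], Prop)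

/-- `M` has a resolution of length `n` by modules in `𝒢`, defined by splicing short exact
sequences. -/
def HasRes : ℕ → ModuleCat.{u} R → Prop
  | 0, M => 𝒢 M
  | n + 1, M => ∃ K G : ModuleCat.{u} R, HasRes n K ∧ 𝒢 G ∧ IsExtension R K G M

variable {R 𝒢}

theorem HasRes.mono {𝒢' : ∀ (G : Type u) [AddCommGroup G] [Module R G], Prop}
    (h : ∀ (G : Type u) [AddCommGroup G] [Module R G], 𝒢 G → 𝒢' G) {n : ℕ} {M : ModuleCat.{u} R}
    (hM : HasRes R 𝒢 n M) : HasRes R 𝒢' n M := by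
  induction n generalizing M with
  | zero => exact h _ hM
  | succ n ih =>
    obtain ⟨K, G, hK, hG, hs⟩ := hM
    exact ⟨K, G, ih hK, h _ hG, hs⟩

/-- Splice a resolution of `K` with `0 → K → G → M → 0`. -/
noncomputable def Resolution.cons {M K G : Type u} [AddCommGroup M] [Module R M] [AddCommGroup K]
    [Module R K] [AddCommGroup G] [Module R G] {n : ℕ} (ρ : Resolution R 𝒢 K n) (hG : 𝒢 G)
    {f : K →ₗ[R] G} {g : G →ₗ[R] M} (h : SES f g) : Resolution R 𝒢 M (n + 1) where
  G i := (Nat.casesOn i (ModuleCat.of R G) fun i => ModuleCat.of R (ρ.G i) : ModuleCat.{u} R)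
  d i := match i with
    | 0 => f ∘ₗ ρ.ε
    | i + 1 => ρ.d i
  ε := g
  mem i hi := match i with
    | 0 => hG
    | i + 1 => ρ.mem i (by omega)
  zero i hi := match i with
    | 0 => absurd hi (by omega)
    | i + 1 => ρ.zero i (by omega)
  surjective := h.surj
  exact_zero x := by
    refine (h.exact x).trans ⟨?_, ?_⟩
    · rintro ⟨k, rfl⟩
      obtain ⟨y, rfl⟩ := ρ.surjective k
      exact ⟨y, rfl⟩
    · rintro ⟨y, rfl⟩
      exact ⟨ρ.ε y, rfl⟩
  exact_succ i := match i with
    | 0 => fun x => (map_eq_zero_iff f h.inj).trans (ρ.exact_zero x)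
    | i + 1 => ρ.exact_succ i

/-- The resolution of length zero of a module in `𝒢`. -/
noncomputable def Resolution.single {M : Type u} [AddCommGroup M] [Module R M] (hM : 𝒢 M) :
    Resolution R 𝒢 M 0 where
  G i := (Nat.casesOn i (ModuleCat.of R M) fun _ => ModuleCat.of R PUnit.{u + 1} :
    ModuleCat.{u} R)
  d i := 0
  ε := LinearMap.id
  mem i hi := match i with
    | 0 => hM
    | i + 1 => absurd hi (by omega)
  zero i hi := match i with
    | 0 => absurd hi (by omega)
    | i + 1 => inferInstanceAs (Subsingleton PUnit.{u + 1})
  surjective := Function.surjective_id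
  exact_zero x := ⟨fun h => ⟨0, h.symm⟩, fun ⟨_, h⟩ => h.symm⟩
  exact_succ i x := ⟨fun _ => ⟨0, Subsingleton.elim (α := PUnit.{u + 1}) _ _⟩, fun _ => rfl⟩

theorem HasRes.nonempty_resolution {n : ℕ} {M : ModuleCat.{u} R} (hM : HasRes R 𝒢 n M) :
    Nonempty (Resolution R 𝒢 M n) := by
  induction n generalizing M with
  | zero => exact ⟨Resolution.single hM⟩
  | succ n ih =>
    obtain ⟨K, G, hK, hG, f, g, hs⟩ := hM
    obtain ⟨ρ⟩ := ih hK
    exact ⟨ρ.cons hG hs⟩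

theorem Resolution.hasRes (h𝒢 : ∀ (G G' : Type u) [AddCommGroup G] [Module R G] [AddCommGroup G']
    [Module R G'], (G ≃ₗ[R] G') → 𝒢 G → 𝒢 G') {n : ℕ} {M : Type u} [AddCommGroup M] [Module R M]
    (ρ : Resolution R 𝒢 M n) : HasRes R 𝒢 n (ModuleCat.of R M) := by
  induction n generalizing M with
  | zero =>
    have := ρ.zero 1 (by omega)
    refine h𝒢 (ρ.G 0) M (LinearEquiv.ofBijective ρ.ε ⟨?_, ρ.surjective⟩) (ρ.mem 0 le_rfl)
    rw [injective_iff_map_eq_zero]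
    intro x hx
    obtain ⟨y, rfl⟩ := (ρ.exact_zero x).1 hx
    have hy : y = 0 := Subsingleton.elim (α := ρ.G 1) _ _
    rw [hy, map_zero]
  | succ n ih =>
    let σ : Resolution R 𝒢 (LinearMap.range (ρ.d 0)) n :=
      { G := fun i => ρ.G (i + 1)
        d := fun i => ρ.d (i + 1)
        ε := (ρ.d 0).rangeRestrict
        mem := fun i hi => ρ.mem (i + 1) (by omega)
        zero := fun i hi => ρ.zero (i + 1) (by omega)
        surjective := LinearMap.surjective_rangeRestrict _
        exact_zero := fun x => by
          rw [← ρ.exact_succ 0 x, ← Subtype.val_inj]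
          rfl
        exact_succ := fun i => ρ.exact_succ (i + 1) }
    exact ⟨ModuleCat.of R (LinearMap.range (ρ.d 0)), ModuleCat.of R (ρ.G 0), ih σ,
      ρ.mem 0 (by omega), Submodule.subtype _, ρ.ε, Subtype.val_injective, ρ.surjective, fun x =>
        (ρ.exact_zero x).trans (by simp)⟩

theorem resolutionDim_le_iff (h𝒢 : ∀ (G G' : Type u) [AddCommGroup G] [Module R G]
    [AddCommGroup G'] [Module R G'], (G ≃ₗ[R] G') → 𝒢 G → 𝒢 G') (M : Type u) [AddCommGroup M]
    [Module R M] (n : ℕ) :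
    resolutionDim R 𝒢 M ≤ n ↔ ∃ k ≤ n, HasRes R 𝒢 k (ModuleCat.of R M) := by
  constructor
  · intro h
    rcases Set.eq_empty_or_nonempty
      {l : ℕ∞ | ∃ n : ℕ, l = n ∧ Nonempty (Resolution R 𝒢 M n)} with he | hne
    · rw [resolutionDim, he, sInf_empty] at h
      exact absurd h (by simp)
    · obtain ⟨k, hk, ⟨ρ⟩⟩ := csInf_mem hne
      rw [resolutionDim, hk] at h
      exact ⟨k, by exact_mod_cast h, ρ.hasRes h𝒢⟩
  · rintro ⟨k, hk, h⟩
    refine (sInf_le ?_).trans (Nat.cast_le.2 hk)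
    exact ⟨k, rfl, h.nonempty_resolution⟩

theorem pd_le_iff (M : Type u) [AddCommGroup M] [Module R M] (n : ℕ) :
    pd R M ≤ n ↔ PdLE R M n := by
  rw [PdLE, ← CategoryTheory.projectiveDimension_le_iff, pd]
  cases CategoryTheory.projectiveDimension (ModuleCat.of R M) with
  | bot => simp
  | coe a =>
    rw [WithBot.unbotD_coe]
    exact (WithBot.coe_le_coe (a := a) (b := (n : ℕ∞))).symm

theorem HasRes.of_pdLE {M : ModuleCat.{u} R} {n : ℕ} (h : PdLE R M n) :
    HasRes R (fun P _ _ => Module.Projective R P) n M := by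
  induction n generalizing M with
  | zero => exact (pdLE_zero_iff (R := R) M).1 h
  | succ n ih =>
    obtain ⟨P, K, hP, f, g, hs⟩ := exists_projective_cover (R := R) M
    exact ⟨K, P, ih ((hs.shortExact.hasProjectiveDimensionLT_X₃_iff n
      ((projective_iff (R := R) P).1 hP)).1 h), hP, f, g, hs⟩

end Resolutions

/-! ### Approximations and comparison of resolution dimensions -/

section Comparison

variable {R : Type u} [Ring R] {𝒩 : ∀ (N : Type u) [AddCommGroup N] [Module R N], Prop}

theorem HasRes.extZero {m : ℕ} {M : ModuleCat.{u} R}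
    (h : HasRes R (fun G _ _ => IsCompleteSyzygy R 𝒩 G) m M) {N : Type u} [AddCommGroup N]
    [Module R N] (hN : 𝒩 N) (i : ℕ) (hi : m < i) : ExtZero R M N i := by
  induction m generalizing M i with
  | zero =>
    obtain ⟨i, rfl⟩ : ∃ j, i = j + 1 := ⟨i - 1, by omega⟩
    exact IsCompleteSyzygy.extZero_succ h hN i
  | succ m ih =>
    obtain ⟨i, rfl⟩ : ∃ j, i = j + 1 := ⟨i - 1, by omega⟩
    obtain ⟨K, G, hK, hG, f, g, hs⟩ := h
    exact hs.extZero_right (ih hK i (by omega)) (hG.extZero_succ hN i)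

/-- Embed `E` in a projective `Q` with complete syzygy cokernel `G`, and take `Z = Q / Y`, which
contains `E / Y = M`. -/
theorem IsCompleteSyzygy.exists_coapproximation {n : ℕ} {M Y E : ModuleCat.{u} R} (hY : PdLE R Y n)
    (hE : IsCompleteSyzygy R 𝒩 E) (h : IsExtension R Y E M) : ∃ Z G : ModuleCat.{u} R,
      PdLE R Z (n + 1) ∧ IsCompleteSyzygy R 𝒩 G ∧ IsExtension R M Z G := by
  obtain ⟨f, g, hs⟩ := h
  obtain ⟨Q, G, hQ, hG, i, p, hi⟩ := hE.exists_embedding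
  obtain ⟨Z, ⟨a, b, hZ⟩, hZ'⟩ := exists_cokernel_comp hs hi
  exact ⟨Z, G, (hZ.shortExact.hasProjectiveDimensionLT_X₃_iff n
    ((projective_iff (R := R) Q).1 hQ)).2 hY, hG, hZ'⟩

variable (h𝒩 : ∀ (Q : Type u) [AddCommGroup Q] [Module R Q], Module.Projective R Q → 𝒩 Q)
include h𝒩

/-- A module with a finite resolution by complete syzygies has a complete syzygy as an
approximation whose kernel has finite projective dimension. -/
theorem HasRes.exists_approximation {n : ℕ} {M : ModuleCat.{u} R}
    (h : HasRes R (fun G _ _ => IsCompleteSyzygy R 𝒩 G) (n + 1) M) : ∃ Y E : ModuleCat.{u} R,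
      PdLE R Y n ∧ IsCompleteSyzygy R 𝒩 E ∧ IsExtension R Y E M := by
  induction n generalizing M with
  | zero =>
    obtain ⟨K, G, hK, hG, f, g, hs⟩ := h
    obtain ⟨P, K', hP, hK', i, p, hi⟩ := IsCompleteSyzygy.exists_embedding (M := K) hK
    obtain ⟨E, hE, hE'⟩ := exists_pushout hs hi
    exact ⟨P, E, (pdLE_zero_iff (R := R) P).2 hP,
      IsCompleteSyzygy.of_isExtension h𝒩 hG hK' hE', hE⟩
  | succ n ih =>
    obtain ⟨K, G, hK, hG, f, g, hs⟩ := h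
    obtain ⟨Y, E, hY, hE, he⟩ := ih hK
    obtain ⟨Z, K', hZ, hK', i, p, hi⟩ := IsCompleteSyzygy.exists_coapproximation hY hE he
    -- The pushout along `K → Z` is an extension of `M` by `Z` and also of `K'` by `G`; the second
    -- makes it a complete syzygy.
    obtain ⟨E', hE', hE''⟩ := exists_pushout hs hi
    exact ⟨Z, E', hZ, IsCompleteSyzygy.of_isExtension h𝒩 hG hK' hE'', hE'⟩

/-- A finite resolution dimension by complete syzygies is bounded by the Gorenstein projective dimension. -/
theorem HasRes.exists_le {n m : ℕ} {M : ModuleCat.{u} R}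
    (h : HasRes R (fun G _ _ => IsCompleteSyzygy R 𝒩 G) n M)
    (h' : HasRes R (fun G _ _ => IsGorensteinProjective R G) m M) :
    ∃ k ≤ m, HasRes R (fun G _ _ => IsCompleteSyzygy R 𝒩 G) k M := by
  rcases n with _ | n
  · exact ⟨0, Nat.zero_le _, h⟩
  have hM : ∀ (Q : Type u) [AddCommGroup Q] [Module R Q], Module.Projective R Q →
      ∀ i, m < i → ExtZero R M Q i := fun Q _ _ hQ =>
    HasRes.extZero (𝒩 := fun Q _ _ => Module.Projective R Q) h' hQ
  obtain ⟨Y, E, hY, hE, f, g, hs⟩ := h.exists_approximation h𝒩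
  -- `Ext^i(Y, Q)` lies between `Ext^i(E, Q) = 0` and `Ext^(i+1)(M, Q)`. Truncated subtraction gives
  -- the bound `0` for `m = 0` as well, where only `i ≥ 1` is needed.
  have hYm : PdLE R Y (m - 1) := pdLE_of_extZero (R := R) (M := Y) hY fun Q _ _ hQ i hi => by
    obtain ⟨i, rfl⟩ : ∃ j, i = j + 1 := ⟨i - 1, by omega⟩
    exact hs.extZero_left (hE.extZero_succ (h𝒩 Q hQ) i) (hM Q hQ _ (by omega))
  refine ⟨m, le_rfl, ?_⟩
  rcases m with _ | m
  -- For `m = 0` the kernel `Y` is projective, so `Ext¹(M, Y) = 0` splits the sequence and `Y` can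
  -- be cancelled from `E ≅ Y × M`.
  · have hYp := (pdLE_zero_iff (R := R) Y).1 hYm
    obtain ⟨e⟩ := hs.nonempty_equiv_prod_of_extZero (hM Y hYp 1 (by omega))
    exact IsCompleteSyzygy.of_prod_projective h𝒩 hYp (hE.congr e)
  · exact ⟨Y, E, (HasRes.of_pdLE hYm).mono fun G _ _ hG => IsCompleteSyzygy.of_projective hG, hE,
      f, g, hs⟩

end Comparison

/-! ### PGF, Gorenstein projective and projective dimension -/

section Dimensions

variable (R : Type u) [Ring R]

/-- The modules `N` such that `Hom_R(-, N)` preserves acyclicity of all complexes that define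
PGF-modules. -/
def IsPGFTest (N : Type u) [AddCommGroup N] [Module R N] : Prop :=
  ∀ C : AcyclicProjComplex R, (∀ (I : Type u) [AddCommGroup I] [Module Rᵐᵒᵖ I],
    Module.Injective Rᵐᵒᵖ I → C.TensorAcyclic I) → C.HomAcyclic N

variable {R}

theorem isPGFTest_of_projective (Q : Type u) [AddCommGroup Q] [Module R Q]
    (hQ : Module.Projective R Q) : IsPGFTest R Q :=
  fun C hC => C.homAcyclic_of_tensorAcyclic hC Q hQ

/-- By duality, `J⁺` is a test module for every injective `J`, so acyclicity against test modules
already forces acyclicity of `J ⊗ C`. This makes the general theory of complete syzygies available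
for PGF-modules. -/
theorem isPGF_iff (M : Type u) [AddCommGroup M] [Module R M] :
    IsPGF R M ↔ IsCompleteSyzygy R (fun N _ _ => IsPGFTest R N) M := by
  constructor
  · rintro ⟨C, hC, h⟩
    exact ⟨C, fun N _ _ hN => hN C hC, h⟩
  · rintro ⟨C, hC, h⟩
    exact ⟨C, fun I _ _ hI => C.tensorAcyclic_iff.2
      (hC _ fun C' hC' => C'.tensorAcyclic_iff.1 (hC' I hI)), h⟩

/-- PGF-modules are Gorenstein projective. -/
theorem IsPGF.isGorensteinProjective {M : Type u} [AddCommGroup M] [Module R M]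
    (h : IsPGF R M) : IsGorensteinProjective R M := by
  obtain ⟨C, hC, h⟩ := h
  exact ⟨C, fun Q _ _ hQ => isPGFTest_of_projective Q hQ C hC, h⟩

theorem pgfDim_le_iff (M : Type u) [AddCommGroup M] [Module R M] (n : ℕ) :
    pgfDim R M ≤ n ↔ ∃ k ≤ n, HasRes R (fun G _ _ => IsPGF R G) k (ModuleCat.of R M) :=
  resolutionDim_le_iff (fun G G' _ _ _ _ e h => (isPGF_iff G').2 (((isPGF_iff G).1 h).congr e)) M n

theorem gpd_le_iff (M : Type u) [AddCommGroup M] [Module R M] (n : ℕ) :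
    gpd R M ≤ n ↔
      ∃ k ≤ n, HasRes R (fun G _ _ => IsGorensteinProjective R G) k (ModuleCat.of R M) :=
  resolutionDim_le_iff (fun G G' _ _ _ _ e h =>
    IsCompleteSyzygy.congr (R := R) (M := G) (M' := G') (𝒩 := fun Q _ _ => Module.Projective R Q) h e) M n

theorem enat_le_of_forall {a b : ℕ∞} (h : ∀ n : ℕ, b ≤ n → a ≤ n) : a ≤ b := by
  cases b with
  | top => exact le_top
  | coe n => exact h n le_rfl

variable (M : Type u) [AddCommGroup M] [Module R M]

theorem pgfDim_le_pd : pgfDim R M ≤ pd R M := enat_le_of_forall fun n hn =>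
  (pgfDim_le_iff M n).2 ⟨n, le_rfl, (HasRes.of_pdLE ((pd_le_iff M n).1 hn)).mono fun G _ _ hG =>
    (isPGF_iff G).2 (IsCompleteSyzygy.of_projective hG)⟩

theorem gpd_le_pgfDim : gpd R M ≤ pgfDim R M := enat_le_of_forall fun n hn => by
  obtain ⟨k, hk, h⟩ := (pgfDim_le_iff M n).1 hn
  exact (gpd_le_iff M n).2 ⟨k, hk, h.mono fun G _ _ hG => hG.isGorensteinProjective⟩

/-- A PGF-resolution of length `k` kills `Ext` into projectives above `k`, because projectives are
test modules; once `pd` is finite, this vanishing bounds it. -/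
theorem pd_le_pgfDim (h : pd R M < ⊤) : pd R M ≤ pgfDim R M := enat_le_of_forall fun n hn => by
  obtain ⟨m, hm⟩ := ENat.ne_top_iff_exists.1 h.ne
  obtain ⟨k, hk, hres⟩ := (pgfDim_le_iff M n).1 hn
  have hres' := hres.mono (𝒢' := fun G _ _ => IsCompleteSyzygy R (fun N _ _ => IsPGFTest R N) G)
    fun G _ _ hG => (isPGF_iff G).1 hG
  refine (pd_le_iff M n).2 (pdLE_of_extZero ((pd_le_iff M m).1 hm.ge) fun Q _ _ hQ i hi => ?_)
  exact hres'.extZero (isPGFTest_of_projective Q hQ) i (by omega)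

theorem pgfDim_le_gpd (h : pgfDim R M < ⊤) : pgfDim R M ≤ gpd R M :=
  enat_le_of_forall fun n hn => by
    obtain ⟨m, hm⟩ := ENat.ne_top_iff_exists.1 h.ne
    obtain ⟨k, -, hres⟩ := (pgfDim_le_iff M m).1 hm.ge
    obtain ⟨l, hl, hres'⟩ := (gpd_le_iff M n).1 hn
    have hres := hres.mono (𝒢' := fun G _ _ => IsCompleteSyzygy R (fun N _ _ => IsPGFTest R N) G)
      fun G _ _ hG => (isPGF_iff G).1 hG
    obtain ⟨j, hj, hfin⟩ := hres.exists_le isPGFTest_of_projective hres'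
    exact (pgfDim_le_iff M n).2 ⟨j, hj.trans hl, hfin.mono fun G _ _ hG => (isPGF_iff G).2 hG⟩

end Dimensions

end PGF

theorem corollary3p7 {R : Type u} [Ring R] (M : Type u) [AddCommGroup M] [Module R M] :
    (PGF.pd R M < ⊤ → PGF.pgfDim R M = PGF.pd R M) ∧
    (PGF.pgfDim R M < ⊤ → PGF.gpd R M = PGF.pgfDim R M) ∧
    (PGF.gpd R M ≤ PGF.pgfDim R M ∧ PGF.pgfDim R M ≤ PGF.pd R M) :=
  ⟨fun h => (PGF.pgfDim_le_pd M).antisymm (PGF.pd_le_pgfDim M h),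
    fun h => (PGF.gpd_le_pgfDim M).antisymm (PGF.pgfDim_le_gpd M h),
    PGF.gpd_le_pgfDim M, PGF.pgfDim_le_pd M⟩
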